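/- Consider the real qubit: its states are the real positive semidefinite $2\times2$ matrices of trace $1$, and its measurements are the real POVMs with finitely many outcomes, i.e. finite families $(M_b)_b$ of real positive semidefinite $2\times 2$ matrices with $\sum_b M_b=\mathbb 1$. A classical simulation protocol with $d$ messages consists of a probability space $(\Lambda,\pi)$ (shared randomness), encodings $p_A(c|\rho,\lambda)$ and decodings $p_B(b|c,M,\lambda)$, $c\in\{1,\dots,d\}$, which are probability distributions over $c$ and over $b$, respectively, depending measurably on $\lambda$, such that $$\operatorname{tr}(\rho M_b)=\int_\Lambda \sum_{c=1}^{d}p_A(c|\rho,\lambda)\,p_B(b|c,M,\lambda)\,d\pi(\lambda)$$ for all states $\rho$, all measurements $M$ and all outcomes $b$. It is optimal if no classical simulation protocol uses fewer messages. The encoding is deterministic if each $\rho$ and $\lambda$ determine one message $c(\rho,\lambda)$ that is sent with probability $1$; then $N(\lambda)\in\mathbb N\cup\{\infty\}$ denotes the number of times that $c(\rho,\lambda)$ changes when $\rho=\rho_\theta=\frac12(\mathbb 1+\cos\theta\,\sigma_x+\sin\theta\,\sigma_z)$ traverses the equator once, that is, the supremum over all finite sequences $0\le\theta_0\le\dots\le\theta_n\le2\pi$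 of the number of $i<n$ with $c(\rho_{\theta_i},\lambda)\ne c(\rho_{\theta_{i+1}},\lambda)$. (a) Let an optimal classical simulation protocol for the real qubit with $d_C$ messages be given. Then either (i) $d_C=3$ and, if the encoding is deterministic, $\max_\lambda N(\lambda)\ge 7$, where $\lambda$-sets of probability zero are disregarded: the set of $\lambda$ with $N(\lambda)\ge7$ is not a $\pi$-null set; or (ii) $d_C=4$. (b) The bound already holds in the following finite setting with $32$ states and $16$ two-outcome measurements: $\rho_x=\frac12\big(\mathbb 1+\cos(2\pi x/32)\sigma_x+\sin(2\pi x/32)\sigma_z\big)$ for $x=1,\dots,32$, and $M_{\pm|y}=\frac12\big(\mathbb 1\pm\cos(\pi y/16)\sigma_x\pm\sin(\pi y/16)\sigma_z\big)$ for $y=1,\dots,16$. For every classical simulation protocol (defined as above, for these states and measurements only) with $3$ messages and deterministic encoding $c(x,\lambda)$, the set of $\lambda$ with $|\{x : c(x,\lambda)\neq c(x+1,\lambda)\}|\ge 7$, where $x+1$ is taken modulo $32$, is not a $\pi$-null set. That is, this setting cannot be simulated with three messages using only strategies that have fewer than $7$ sections. -/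

import Mathlib

open MeasureTheory Filter

universe u

/-- The real matrix `(1 + a σ_x + b σ_z) / 2`, where `σ_x = !![0, 1; 1, 0]` and
`σ_z = !![1, 0; 0, -1]`. -/
noncomputable def blochMatrix (a b : ℝ) : Matrix (Fin 2) (Fin 2) ℝ :=
  (1 / 2 : ℝ) • ((1 : Matrix (Fin 2) (Fin 2) ℝ) + a • !![0, 1; 1, 0] + b • !![1, 0; 0, -1])

theorem blochMatrix_eq (a b : ℝ) :
    blochMatrix a b = !![(1 + b) / 2, a / 2; a / 2, (1 - b) / 2] := by
  ext i j
  fin_cases i <;> fin_cases j <;> simp [blochMatrix] <;> ring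

theorem blochMatrix_posSemidef {a b : ℝ} (h : a ^ 2 + b ^ 2 = 1) :
    (blochMatrix a b).PosSemidef := by
  have key : blochMatrix a b = (blochMatrix a b).conjTranspose * blochMatrix a b := by
    rw [blochMatrix_eq]
    ext i j
    fin_cases i <;> fin_cases j <;>
      simp [Matrix.mul_apply, Fin.sum_univ_two] <;> nlinarith
  rw [key]
  exact Matrix.posSemidef_conjTranspose_mul_self _

theorem blochMatrix_trace (a b : ℝ) : (blochMatrix a b).trace = 1 := by
  rw [blochMatrix_eq]
  simp [Matrix.trace, Fin.sum_univ_two]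
  ring

/-- States of the real qubit: real `2 × 2` density matrices. -/
structure RebitState where
  mat : Matrix (Fin 2) (Fin 2) ℝ
  posSemidef : mat.PosSemidef
  trace_eq_one : mat.trace = 1

/-- Measurements of the real qubit with outcome set `B`: real POVMs. -/
structure RebitPOVM (B : Type) [Fintype B] where
  effect : B → Matrix (Fin 2) (Fin 2) ℝ
  posSemidef : ∀ b, (effect b).PosSemidef
  sum_eq_one : ∑ b, effect b = 1

/-- Born's rule. -/
def bornProb {B : Type} [Fintype B] (ρ : RebitState) (M : RebitPOVM B) (b : B) : ℝ :=
  (ρ.mat * M.effect b).trace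

/-- A classical model of the behavior `p(b|x,y)` with messages `c ∈ {1, …, d}`: a probability
space of shared randomness `l ∈ Λ`, encodings `p_A(c|x,l)` and decodings `p_B(b|c,y,l)`,
such that `p(b|x,y) = ∫ ∑_c p_A(c|x,l) p_B(b|c,y,l)`. The outcome set may depend on `y`. -/
structure ClassicalModel {X Y : Type} {B : Y → Type} [∀ y, Fintype (B y)]
    (p : X → (y : Y) → B y → ℝ) (d : ℕ) (Λ : Type u) [MeasurableSpace Λ] where
  prob : Measure Λ
  isProbabilityMeasure : IsProbabilityMeasure prob
  /-- `enc x l c = p_A(c|x,l)` -/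
  enc : X → Λ → Fin d → ℝ
  enc_measurable : ∀ x c, Measurable fun l => enc x l c
  enc_nonneg : ∀ x l c, 0 ≤ enc x l c
  enc_sum : ∀ x l, ∑ c, enc x l c = 1
  /-- `dec c y l b = p_B(b|c,y,l)` -/
  dec : Fin d → (y : Y) → Λ → B y → ℝ
  dec_measurable : ∀ c y b, Measurable fun l => dec c y l b
  dec_nonneg : ∀ c y l b, 0 ≤ dec c y l b
  dec_sum : ∀ c y l, ∑ b, dec c y l b = 1
  simulates : ∀ x y b, ∫ l, ∑ c, enc x l c * dec c y l b ∂prob = p x y b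

namespace ClassicalModel

variable {X Y : Type} {B : Y → Type} [∀ y, Fintype (B y)] {p : X → (y : Y) → B y → ℝ}
  {d : ℕ} {Λ : Type u} [MeasurableSpace Λ]

/-- The encoding is deterministic: for shared randomness `l`, input `x` is always encoded in the
message `D x l`. -/
def IsDeterministicEncoding (P : ClassicalModel p d Λ) (D : X → Λ → Fin d) : Prop :=
  ∀ x l c, P.enc x l c = if D x l = c then 1 else 0

/-- No classical model of the same behavior uses fewer messages. -/
def IsOptimal (_P : ClassicalModel p d Λ) : Prop :=
  ∀ (d' : ℕ) (Λ' : Type u) [MeasurableSpace Λ'], Nonempty (ClassicalModel p d' Λ') → d ≤ d'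

end ClassicalModel

/-- The behavior of the full real qubit: the inputs of Alice are all states, and the inputs of Bob
are all POVMs with finitely many outcomes. -/
def rebitBehavior (ρ : RebitState) (M : Σ k : ℕ, RebitPOVM (Fin k)) (b : Fin M.1) : ℝ :=
  bornProb ρ M.2 b

/-- The pure state with Bloch vector `(cos θ, sin θ)` in the `xz`-plane. -/
noncomputable def equatorState (θ : ℝ) : RebitState where
  mat := blochMatrix (Real.cos θ) (Real.sin θ)
  posSemidef := blochMatrix_posSemidef (Real.cos_sq_add_sin_sq θ)
  trace_eq_one := blochMatrix_trace _ _

/-- The projective measurement onto the states with Bloch vectors `± (cos φ, sin φ)`; outcome `0`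
is `+`, outcome `1` is `-`. -/
noncomputable def equatorMeasurement (φ : ℝ) : RebitPOVM (Fin 2) where
  effect := ![blochMatrix (Real.cos φ) (Real.sin φ), blochMatrix (-Real.cos φ) (-Real.sin φ)]
  posSemidef b := by
    fin_cases b
    · exact blochMatrix_posSemidef (Real.cos_sq_add_sin_sq φ)
    · exact blochMatrix_posSemidef (by simp)
  sum_eq_one := by
    simp only [Fin.sum_univ_two, Matrix.cons_val_zero, Matrix.cons_val_one, blochMatrix_eq]
    ext i j
    fin_cases i <;> fin_cases j <;> simp <;> ring

/-- The number of times that the message assigned by `c` changes when all pure states along the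
equator are traversed once: the supremum, over all finite sequences of points met in this order on
the way from angle `0` to angle `2π` (the same state again), of the number of consecutive points
with different messages. -/
noncomputable def sectionNumber {d : ℕ} (c : RebitState → Fin d) : ℕ∞ :=
  ⨆ (n : ℕ) (θ : ℕ → ℝ) (_ : Monotone θ ∧ ∀ i, θ i ∈ Set.Icc 0 (2 * Real.pi)),
    (((Finset.range n).filter
      fun i => c (equatorState (θ i)) ≠ c (equatorState (θ (i + 1)))).card : ℕ∞)

/-- The behavior of the real-qubit setting with 32 states at angles `2πx/32`, `x = 1, …, 32`, and
16 two-outcome measurements at angles `πy/16`, `y = 1, …, 16`. -/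
noncomputable def gridBehavior (x : Fin 32) (y : Fin 16) (b : Fin 2) : ℝ :=
  bornProb (equatorState (2 * Real.pi * ((x.val : ℝ) + 1) / 32))
    (equatorMeasurement (Real.pi * ((y.val : ℝ) + 1) / 16)) b

/-- The number of message changes along the cyclically ordered inputs `x = 1, …, 32`; here
`x + 1` is taken modulo 32. -/
def gridSectionNumber {d : ℕ} (c : Fin 32 → Fin d) : ℕ :=
  (Finset.univ.filter fun x : Fin 32 => c x ≠ c (x + 1)).card

/-! Sections. Let `wit` be the antiperiodic integer function on ℤ/32 with values 12 at 0 and 11 at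
±5, ±6. Pair `wit (x - y)` with the correlations between the 32 states and the 16 measurements. The
real qubit has correlations cos(2π(x - y)/32) and reaches 16 (24 + 44 cos(5π/16) + 44 cos(3π/8)) >
1044 (`lt_sum_gridBehavior`). For a deterministic encoding `c`, Bob's best responses give the sum of
`|corr c k y|` over messages and measurements, and this is at most 1044 whenever `c` changes at most
six times around the cycle (`cyclicTotal_le`). If almost all strategies had at most six changes,
their average could not reach the quantum value. A protocol for the full real qubit restricts to the
grid, and its sections are at least those on the grid.

The combinatorial bound is a branch and bound over colorings of the 32-cycle. Six changes leave a
run of length at least 6; after a rotation it comes first, and at most four changes remain after the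
one that ends it. A partial coloring is discarded when the unread inputs, worth at most 56 each,
cannot lift its value above 1044. The 32 entries of each message's vector are digits of one natural
number, so that a step of the search is a few operations on large integers. `check_eq_true`
evaluates the search, and `total_le_of_check` shows that it misses nothing.

Number of messages. Two messages violate a CHSH-like inequality, with bound 4 against the quantum
value 4√2 (`three_le_of_classicalModel`).

Four messages suffice (`FourMessages.model`). Two independent uniform directions α, β are shared,
and Alice sends on which side of each the state lies. A single direction drawn with density
proportional to `load` would reproduce Born's rule. Bob obtains this density by choosing between α
and β with weights whose dependence on the pair is antisymmetric up to a constant, so that they have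
a fixed sum, and whose average over β is the required density (`integral_kernel`,
`integral_choice`). -/

namespace SectionSearch

/-! ### The witness and the branch-and-bound search -/

/-- Positive part of the antiperiodic witness on `ℤ/32`, which is `12` at `0` and `11` at
`±5, ±6`. -/
def weight (t : ℕ) : ℕ :=
  if t = 0 then 12 else if t = 5 ∨ t = 6 ∨ t = 26 ∨ t = 27 then 11 else 0

/-- The number with base-`8192` digits `u 0, …, u (n - 1)`. -/
def pack (u : ℕ → ℕ) : ℕ → ℕ
  | 0 => 0
  | n + 1 => pack u n + u n * 8192 ^ n

/-- Evaluates `n` before it is substituted in `k`. -/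
noncomputable def force {α : Type} (n : ℕ) (k : ℕ → α) : α :=
  Nat.rec (k 0) (fun m _ => k (Nat.succ m)) n

/-- Packed contribution of the input `x`: `pos - neg`. The fields `sufPos`, `sufNeg` are the sums
over all inputs from `x` on, and `rest` is `56` times the number of these inputs. -/
structure Row where
  pos : ℕ
  neg : ℕ
  sufPos : ℕ
  sufNeg : ℕ
  rest : ℕ

def posRow (x : ℕ) : ℕ := pack (fun y => weight ((x + 32 - y) % 32)) 32

/-- A shift by 16 turns the positive part of the witness into its negative part; 48 = 32 + 16 keeps
the truncated subtraction exact. -/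
def negRow (x : ℕ) : ℕ := pack (fun y => weight ((x + 48 - y) % 32)) 32

/-- `∑ g x` over the last `m` of the inputs `0, …, 31`. -/
def suffixSum (g : ℕ → ℕ) : ℕ → ℕ
  | 0 => 0
  | m + 1 => suffixSum g m + g (31 - m)

/-- The rows of the last `m` inputs. -/
def lastRows : ℕ → List Row
  | 0 => []
  | m + 1 => ⟨posRow (31 - m), negRow (31 - m), suffixSum posRow (m + 1),
      suffixSum negRow (m + 1), 56 * (m + 1)⟩ :: lastRows m

noncomputable def forceRows {α : Type} (l : List Row) : (List Row → α) → α :=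
  List.rec (fun k => k [])
    (fun row _ ih k => force row.pos fun p => force row.neg fun q => force row.sufPos fun p' =>
      force row.sufNeg fun q' => force row.rest fun r => ih fun l => k (⟨p, q, p', q', r⟩ :: l)) l

/-- The digit `128` in all `32` positions; it represents the zero vector. -/
def bias : ℕ := pack (fun _ => 128) 32

/-- Replaces every digit `u < 256` by `max (u - 128) 0`, if `hi` is `bias`. -/
def posPart (hi x : ℕ) : ℕ :=
  Nat.land x (Nat.sub (Nat.land x hi) (Nat.shiftRight (Nat.land x hi) 7))

/-- Because 8192 ≡ 1 modulo 8191, the remainder is the sum of all digits. The three sums are at most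
3 · 32 · 56 = 5376 in total, so the remainder is the sum itself. -/
def value (hi u v w : ℕ) : ℕ :=
  Nat.mod (Nat.add (posPart hi u) (Nat.add (posPart hi v) (posPart hi w))) 8191

noncomputable def addRow (x : ℕ) (row : Row) (k : ℕ → Bool) : Bool :=
  force (Nat.sub (Nat.add x row.pos) row.neg) k

/-- The numbers are the packed vectors of the three messages, the current message first; a search
from a message that is not the final one has the final one last. The answer `true` certifies that no
admissible completion exceeds 1044, the integer part of the quantum value. -/
abbrev Search := List Row → ℕ → ℕ → ℕ → Bool

/-- The current message is the final one, and no change is left. -/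
noncomputable def on0 (hi : ℕ) : Search := fun rows F U V =>
  List.rec (Nat.ble (value hi F U V) 1044)
    (fun row _ _ => Nat.ble (value hi (Nat.sub (Nat.add F row.sufPos) row.sufNeg) U V) 1044) rows

/-- One change is left. The next `s` positions of this change are skipped. -/
noncomputable def scan (hi : ℕ) : List Row → ℕ → ℕ → ℕ → ℕ → Bool :=
  List.rec (fun _ _ _ _ => true) fun row _ ih s U V F =>
    Nat.rec
      (force (value hi U V (Nat.sub (Nat.add F row.sufPos) row.sufNeg)) fun v =>
        Bool.rec false (addRow U row fun U' => ih (Nat.div (Nat.sub 1044 v) 112) U' V F)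
          (Nat.ble v 1044))
      (fun s _ => addRow U row fun U' => ih s U' V F) s

/-- The current message is the final one; `off` treats the situation after a change. -/
noncomputable def mkOn (hi : ℕ) (off : Search) : Search :=
  List.rec (fun F U V => Nat.ble (value hi F U V) 1044) fun row rows ih F U V =>
    Bool.rec (Bool.rec false (Bool.rec false (addRow V row fun V' => off rows V' U F)
      (addRow U row fun U' => off rows U' V F)) (addRow F row fun F' => ih F' U V)) true
      (Nat.ble (Nat.add (value hi F U V) row.rest) 1044)

/-- The current message, with packed vector `U`, is not the final one, with packed vector `F`. -/
noncomputable def mkOff (hi : ℕ) (on off : Search) : Search :=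
  List.rec (fun _ _ _ => true) fun row rows ih U V F =>
    Bool.rec (Bool.rec false (Bool.rec false (addRow V row fun V' => off rows V' U F)
      (addRow F row fun F' => on rows F' U V)) (addRow U row fun U' => ih U' V F)) true
      (Nat.ble (Nat.add (value hi U V F) row.rest) 1044)

/-- The searches with at most `k + 1` changes left, from a final and from another message. -/
noncomputable def searches (hi : ℕ) (k : ℕ) : Search × Search :=
  Nat.rec (on0 hi, fun rows => scan hi rows 0)
    (fun _ ih => (mkOn hi ih.2, mkOff hi ih.1 ih.2)) k

/-- Runs `k` after the next `L` inputs have been added to `U`. -/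
noncomputable def afterRun (k : List Row → ℕ → Bool) (L : ℕ) : List Row → ℕ → Bool :=
  Nat.rec k (fun _ ih rows U =>
    List.rec true (fun row rest _ => addRow U row fun U' => ih rest U') rows) L

noncomputable def afterFirstChange (hi : ℕ) (rows : List Row) (U : ℕ) : Bool :=
  List.rec true (fun row rest _ => Bool.rec false
    (addRow hi row fun V => (searches hi 3).2 rest V U hi)
    (addRow hi row fun F => (searches hi 3).1 rest F U hi)) rows

/-- The search over all strategies whose first run has length `L`. -/
noncomputable def check (L : ℕ) : Bool :=
  force bias fun hi => forceRows (lastRows 32) fun rows =>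
    afterRun (afterFirstChange hi) L rows hi

/-! ### Evaluation of the search -/

theorem check_six : check 6 = true := by decide +kernel

theorem check_seven : check 7 = true := by decide +kernel

theorem check_eight : check 8 = true := by decide +kernel

theorem check_nine_to_eleven : (List.range' 9 3).all check = true := by decide +kernel

theorem check_twelve_to_thirtyone : (List.range' 12 20).all check = true := by decide +kernel

theorem check_eq_true {L : ℕ} (h : 6 ≤ L) (h' : L ≤ 31) : check L = true := by
  rcases lt_or_ge L 9 with h9 | h9
  · interval_cases L
    exacts [check_six, check_seven, check_eight]
  · rcases lt_or_ge L 12 with h12 | h12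
    · exact List.all_eq_true.1 check_nine_to_eleven L (by simp; omega)
    · exact List.all_eq_true.1 check_twelve_to_thirtyone L (by simp; omega)

end SectionSearch

namespace SectionSearch

theorem force_eq {α : Type} (n : ℕ) (k : ℕ → α) : force n k = k n := by
  cases n <;> rfl

theorem forceRows_eq {α : Type} (l : List Row) (k : List Row → α) : forceRows l k = k l := by
  induction l generalizing k with
  | nil => rfl
  | cons row l ih =>
    have : forceRows (row :: l) k = force row.pos fun p => force row.neg fun q =>
      force row.sufPos fun p' => force row.sufNeg fun q' => force row.rest fun r =>
        forceRows l fun l => k (⟨p, q, p', q', r⟩ :: l) := rfl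
    rw [this]
    simp only [force_eq, ih]

/-! ### Packed arithmetic -/

theorem pack_eq_sum (u : ℕ → ℕ) (n : ℕ) : pack u n = ∑ y ∈ Finset.range n, u y * 8192 ^ y := by
  induction n with
  | zero => rfl
  | succ n ih => rw [pack, ih, Finset.sum_range_succ]

theorem pack_congr {u v : ℕ → ℕ} {n : ℕ} (h : ∀ y < n, u y = v y) : pack u n = pack v n := by
  rw [pack_eq_sum, pack_eq_sum]
  exact Finset.sum_congr rfl fun y hy => by rw [h y (Finset.mem_range.1 hy)]

theorem pack_mul (a : ℕ) (u : ℕ → ℕ) (n : ℕ) : pack (fun y => a * u y) n = a * pack u n := by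
  simp only [pack_eq_sum, Finset.mul_sum, mul_assoc]

theorem pack_lt {u : ℕ → ℕ} {n : ℕ} (h : ∀ y < n, u y < 8192) : pack u n < 8192 ^ n := by
  induction n with
  | zero => simp [pack]
  | succ n ih =>
    have h1 := ih fun y hy => h y (by omega)
    have h2 : u n ≤ 8191 := by have := h n (by omega); omega
    rw [pack, pow_succ]
    nlinarith [Nat.mul_le_mul_right (8192 ^ n) h2]

theorem pack_mod (u : ℕ → ℕ) (n : ℕ) : pack u n ≡ ∑ y ∈ Finset.range n, u y [MOD 8191] := by
  induction n with
  | zero => rfl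
  | succ n ih =>
    rw [pack, Finset.sum_range_succ]
    refine ih.add ?_
    have : 8192 ^ n ≡ 1 ^ n [MOD 8191] := Nat.ModEq.pow n rfl
    simpa using this.mul_left (u n)

theorem land_add_mul_two_pow {a b i : ℕ} (ha : a < 2 ^ i) (hb : b < 2 ^ i) (A B : ℕ) :
    (a + A * 2 ^ i) &&& (b + B * 2 ^ i) = (a &&& b) + (A &&& B) * 2 ^ i := by
  have hab : a &&& b < 2 ^ i := Nat.and_lt_two_pow a hb
  refine Nat.eq_of_testBit_eq fun j => ?_
  rw [Nat.testBit_and, add_comm a, add_comm b, add_comm (a &&& b), mul_comm A, mul_comm B,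
    mul_comm (A &&& B), Nat.testBit_two_pow_mul_add _ ha, Nat.testBit_two_pow_mul_add _ hb,
    Nat.testBit_two_pow_mul_add _ hab]
  split_ifs <;> simp

/-- Digits below 8192 = 2 ^ 13 occupy disjoint blocks of 13 bits. -/
theorem pack_land {u v : ℕ → ℕ} {n : ℕ} (hu : ∀ y < n, u y < 8192) (hv : ∀ y < n, v y < 8192) :
    pack u n &&& pack v n = pack (fun y => u y &&& v y) n := by
  induction n with
  | zero => simp [pack]
  | succ n ih =>
    have e : (8192 : ℕ) ^ n = 2 ^ (13 * n) := by rw [pow_mul]; norm_num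
    have h1 := pack_lt fun y (hy : y < n) => hu y (by omega)
    have h2 := pack_lt fun y (hy : y < n) => hv y (by omega)
    rw [e] at h1 h2
    rw [pack, pack, pack, e, land_add_mul_two_pow h1 h2,
      ih (fun y hy => hu y (by omega)) fun y hy => hv y (by omega)]

theorem land_128 : ∀ u < 256, u &&& 128 = 128 * (u / 128) := by decide +kernel

theorem land_127_mul : ∀ u < 256, u &&& 127 * (u / 128) = u - 128 := by decide +kernel

/-- Bit 7 of a digit below 256 tells whether the digit is at least 128. Isolating it and subtracting
its shift by 7 leaves the mask 127 in these digits and 0 in the others; the mask then removes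
exactly the bias. -/
theorem posPart_pack {u : ℕ → ℕ} (hu : ∀ y < 32, u y < 256) :
    posPart bias (pack u 32) = pack (fun y => u y - 128) 32 := by
  have h1 : pack u 32 &&& bias = 128 * pack (fun y => u y / 128) 32 := by
    rw [bias, pack_land (fun y hy => (hu y hy).trans (by norm_num)) (fun _ _ => by norm_num),
      ← pack_mul]
    exact pack_congr fun y hy => land_128 _ (hu y hy)
  have h2 : Nat.sub (128 * pack (fun y => u y / 128) 32)
      (Nat.shiftRight (128 * pack (fun y => u y / 128) 32) 7) =
        pack (fun y => 127 * (u y / 128)) 32 := by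
    have : Nat.shiftRight (128 * pack (fun y => u y / 128) 32) 7 =
        pack (fun y => u y / 128) 32 := by
      change _ >>> 7 = _
      rw [Nat.shiftRight_eq_div_pow]
      omega
    rw [this, pack_mul]
    change (_ : ℕ) - _ = _
    omega
  change pack u 32 &&& Nat.sub (pack u 32 &&& bias) (Nat.shiftRight (pack u 32 &&& bias) 7) = _
  rw [h1, h2, pack_land (fun y hy => (hu y hy).trans (by norm_num))]
  · exact pack_congr fun y hy => land_127_mul _ (hu y hy)
  · intro y hy
    have := hu y hy
    omega

/-! ### Sets of inputs -/

/-- The witness `f (x - y)`. -/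
def wt (x y : ℕ) : ℤ := (weight ((x + 32 - y) % 32) : ℤ) - weight ((x + 48 - y) % 32)

def vec (S : Finset ℕ) (y : ℕ) : ℤ := ∑ x ∈ S, wt x y

def posSum (S : Finset ℕ) : ℕ := ∑ y ∈ Finset.range 32, (vec S y).toNat

/-- The entries of `vec` lie in [-56, 56], so the bias 128 keeps all digits positive and below the
bound 256 of `posPart_pack`. -/
def Rep (X : ℕ) (S : Finset ℕ) : Prop :=
  (X : ℤ) = ∑ y ∈ Finset.range 32, (vec S y + 128) * 8192 ^ y

/-- The constant is 56 = 12 + 4 · 11. Summed over inputs it bounds the entries of `vec`; summed over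
shifts it bounds the effect of one input on the value. -/
theorem sum_weight_pos : ∀ y < 32, ∑ x ∈ Finset.range 32, weight ((x + 32 - y) % 32) = 56 := by
  decide +kernel

theorem sum_weight_neg : ∀ y < 32, ∑ x ∈ Finset.range 32, weight ((x + 48 - y) % 32) = 56 := by
  decide +kernel

theorem sum_wt_toNat : ∀ x < 32, ∑ y ∈ Finset.range 32, (wt x y).toNat = 56 := by
  decide +kernel

theorem sum_neg_wt_toNat : ∀ x < 32, ∑ y ∈ Finset.range 32, (-wt x y).toNat = 56 := by
  decide +kernel

theorem vec_le {S : Finset ℕ} (hS : S ⊆ Finset.range 32) {y : ℕ} (hy : y < 32) :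
    vec S y ≤ 56 := by
  calc vec S y ≤ ∑ x ∈ S, (weight ((x + 32 - y) % 32) : ℤ) :=
        Finset.sum_le_sum fun x _ => by unfold wt; omega
    _ ≤ ∑ x ∈ Finset.range 32, (weight ((x + 32 - y) % 32) : ℤ) :=
        Finset.sum_le_sum_of_subset_of_nonneg hS fun _ _ _ => by positivity
    _ = 56 := by exact_mod_cast sum_weight_pos y hy

theorem neg_le_vec {S : Finset ℕ} (hS : S ⊆ Finset.range 32) {y : ℕ} (hy : y < 32) :
    -56 ≤ vec S y := by
  have : -vec S y ≤ 56 := by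
    calc -vec S y ≤ ∑ x ∈ S, (weight ((x + 48 - y) % 32) : ℤ) := by
          rw [vec, ← Finset.sum_neg_distrib]
          exact Finset.sum_le_sum fun x _ => by unfold wt; omega
      _ ≤ ∑ x ∈ Finset.range 32, (weight ((x + 48 - y) % 32) : ℤ) :=
          Finset.sum_le_sum_of_subset_of_nonneg hS fun _ _ _ => by positivity
      _ = 56 := by exact_mod_cast sum_weight_neg y hy
  omega

theorem vec_union {S T : Finset ℕ} (h : Disjoint S T) (y : ℕ) :
    vec (S ∪ T) y = vec S y + vec T y := Finset.sum_union h

theorem Rep.eq_pack {X : ℕ} {S : Finset ℕ} (h : Rep X S) (hS : S ⊆ Finset.range 32) :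
    X = pack (fun y => (vec S y + 128).toNat) 32 := by
  zify
  rw [h, pack_eq_sum]
  push_cast
  refine Finset.sum_congr rfl fun y hy => ?_
  have := neg_le_vec hS (Finset.mem_range.1 hy)
  rw [Int.toNat_of_nonneg (by omega)]

theorem Rep.posPart_eq {X : ℕ} {S : Finset ℕ} (h : Rep X S) (hS : S ⊆ Finset.range 32) :
    posPart bias X = pack (fun y => (vec S y).toNat) 32 := by
  rw [h.eq_pack hS, posPart_pack]
  · exact pack_congr fun y _ => by omega
  · intro y hy
    have := vec_le hS hy
    omega

theorem value_eq {X Y Z : ℕ} {S T U : Finset ℕ} (hX : Rep X S) (hY : Rep Y T) (hZ : Rep Z U)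
    (hS : S ⊆ Finset.range 32) (hT : T ⊆ Finset.range 32) (hU : U ⊆ Finset.range 32) :
    value bias X Y Z = posSum S + posSum T + posSum U := by
  have bound : ∀ {S : Finset ℕ}, S ⊆ Finset.range 32 → posSum S ≤ 1792 := fun {S} hS => by
    calc posSum S ≤ ∑ _y ∈ Finset.range 32, 56 := Finset.sum_le_sum fun y hy => by
          have := vec_le hS (Finset.mem_range.1 hy)
          omega
      _ = 1792 := by simp
  have e : value bias X Y Z =
      (posPart bias X + (posPart bias Y + posPart bias Z)) % 8191 := rfl
  rw [e, hX.posPart_eq hS, hY.posPart_eq hT, hZ.posPart_eq hU]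
  have h := (pack_mod (fun y => (vec S y).toNat) 32).add
    ((pack_mod (fun y => (vec T y).toNat) 32).add (pack_mod (fun y => (vec U y).toNat) 32))
  rw [h, Nat.mod_eq_of_lt]
  · exact (add_assoc _ _ _).symm
  · have h1 := bound hS
    have h2 := bound hT
    have h3 := bound hU
    unfold posSum at h1 h2 h3
    omega

theorem rep_bias : Rep bias ∅ := by
  simp [Rep, bias, pack_eq_sum, vec]

/-- Over ℤ the update is linear, so no digitwise argument is needed. Truncation does no harm: the
resulting digits are nonnegative, hence so is the number. -/
theorem Rep.union {X : ℕ} {S T : Finset ℕ} (h : Rep X S) (hd : Disjoint S T)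
    (hS : S ∪ T ⊆ Finset.range 32) :
    Rep (Nat.sub (Nat.add X (∑ x ∈ T, posRow x)) (∑ x ∈ T, negRow x)) (S ∪ T) := by
  have key : (X : ℤ) + ((∑ x ∈ T, posRow x : ℕ) : ℤ) - ((∑ x ∈ T, negRow x : ℕ) : ℤ) =
      ∑ y ∈ Finset.range 32, (vec (S ∪ T) y + 128) * 8192 ^ y := by
    rw [h]
    simp only [vec_union hd]
    simp only [posRow, negRow, pack_eq_sum, vec, wt, Nat.cast_sum, Nat.cast_mul, Nat.cast_pow]
    rw [Finset.sum_comm (s := T), Finset.sum_comm (s := T), ← Finset.sum_add_distrib,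
      ← Finset.sum_sub_distrib]
    refine Finset.sum_congr rfl fun y _ => ?_
    rw [← Finset.sum_mul, ← Finset.sum_mul, Finset.sum_sub_distrib (s := T)]
    push_cast
    ring
  have nonneg : (0 : ℤ) ≤ ∑ y ∈ Finset.range 32, (vec (S ∪ T) y + 128) * 8192 ^ y :=
    Finset.sum_nonneg fun y hy => by
      have := neg_le_vec hS (Finset.mem_range.1 hy)
      exact mul_nonneg (by omega) (by positivity)
  unfold Rep
  rw [← key] at nonneg ⊢
  change ((X + (∑ x ∈ T, posRow x) - (∑ x ∈ T, negRow x) : ℕ) : ℤ) = _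
  rw [Nat.cast_sub (by omega)]
  push_cast
  ring

theorem Rep.insert {X : ℕ} {S : Finset ℕ} (h : Rep X S) {x : ℕ} (hx : x < 32)
    (hS : S ⊆ Finset.range x) :
    Rep (Nat.sub (Nat.add X (posRow x)) (negRow x)) (insert x S) := by
  have hd : Disjoint S {x} := by
    rw [Finset.disjoint_singleton_right]
    intro hm
    simpa using hS hm
  have h2 := h.union hd (by
    intro z hz
    rcases Finset.mem_union.1 hz with hz | hz
    · have := hS hz
      simp at this ⊢
      omega
    · simp at hz ⊢
      omega)
  rwa [Finset.sum_singleton, Finset.sum_singleton, Finset.union_comm,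
    ← Finset.insert_eq] at h2

theorem suffixSum_eq (g : ℕ → ℕ) {m : ℕ} (hm : m ≤ 32) :
    suffixSum g m = ∑ x ∈ Finset.Ico (32 - m) 32, g x := by
  induction m with
  | zero => simp [suffixSum]
  | succ m ih =>
    rw [suffixSum, ih (by omega), show 32 - m = 32 - (m + 1) + 1 by omega,
      Finset.sum_eq_sum_Ico_succ_bot (a := 32 - (m + 1)) (by omega),
      show 31 - m = 32 - (m + 1) by omega, add_comm]

theorem Rep.fill {X : ℕ} {S : Finset ℕ} (h : Rep X S) {m : ℕ} (hm : m ≤ 32)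
    (hS : S ⊆ Finset.range (32 - m)) :
    Rep (Nat.sub (Nat.add X (suffixSum posRow m)) (suffixSum negRow m))
      (S ∪ Finset.Ico (32 - m) 32) := by
  rw [suffixSum_eq _ hm, suffixSum_eq _ hm]
  refine h.union ?_ ?_
  · rw [Finset.disjoint_left]
    intro z hz hz'
    have := hS hz
    simp at this hz'
    omega
  · intro z hz
    rcases Finset.mem_union.1 hz with hz | hz
    · have := hS hz
      simp at this ⊢
      omega
    · simp at hz ⊢
      omega

/-- The positive part is subadditive, and the positive parts of the entries of one row add up to 56.
For removals the negative parts play the same role. -/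
theorem posSum_insert_le (S : Finset ℕ) {x : ℕ} (hx : x < 32) :
    posSum (insert x S) ≤ posSum S + 56 := by
  by_cases hm : x ∈ S
  · rw [Finset.insert_eq_of_mem hm]
    omega
  · rw [← sum_wt_toNat x hx, posSum, posSum, ← Finset.sum_add_distrib]
    refine Finset.sum_le_sum fun y _ => ?_
    rw [vec, Finset.sum_insert hm]
    change _ ≤ (vec S y).toNat + _
    rw [show ∑ x ∈ S, wt x y = vec S y from rfl]
    omega

theorem posSum_erase_le (S : Finset ℕ) {x : ℕ} (hx : x < 32) :
    posSum (S.erase x) ≤ posSum S + 56 := by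
  by_cases hm : x ∈ S
  · rw [← sum_neg_wt_toNat x hx, posSum, posSum, ← Finset.sum_add_distrib]
    refine Finset.sum_le_sum fun y _ => ?_
    have : vec S y = wt x y + vec (S.erase x) y := (Finset.add_sum_erase S _ hm).symm
    omega
  · rw [Finset.erase_eq_of_notMem hm]
    omega

theorem posSum_union_le (S : Finset ℕ) {T : Finset ℕ} (hT : T ⊆ Finset.range 32) :
    posSum (S ∪ T) ≤ posSum S + 56 * T.card := by
  induction T using Finset.induction_on with
  | empty => simp
  | insert x T hx ih =>
    have h1 := ih ((Finset.subset_insert x T).trans hT)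
    have h2 := posSum_insert_le (S ∪ T) (x := x) (by
      simpa using hT (Finset.mem_insert_self x T))
    rw [Finset.union_insert, Finset.card_insert_of_notMem hx]
    omega

theorem posSum_sdiff_le (S : Finset ℕ) {T : Finset ℕ} (hT : T ⊆ Finset.range 32) :
    posSum (S \ T) ≤ posSum S + 56 * T.card := by
  induction T using Finset.induction_on with
  | empty => simp
  | insert x T hx ih =>
    have h1 := ih ((Finset.subset_insert x T).trans hT)
    have h2 := posSum_erase_le (S \ T) (x := x) (by
      simpa using hT (Finset.mem_insert_self x T))
    rw [Finset.card_insert_of_notMem hx, Finset.sdiff_insert]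
    omega

end SectionSearch

namespace SectionSearch

/-! ### Strategies -/

/-- The inputs below `n` that are encoded in the message `k`. -/
def cls (c : ℕ → Fin 3) (n : ℕ) (k : Fin 3) : Finset ℕ := (Finset.range n).filter fun x => c x = k

/-- The number of changes between `n` and `31`. -/
def changes (c : ℕ → Fin 3) (n : ℕ) : ℕ := ((Finset.Ico n 31).filter fun i => c i ≠ c (i + 1)).card

/-- Positive parts over all 32 shifts replace absolute values over 16 measurements; antiperiodicity
makes the two sums equal. -/
def total (c : ℕ → Fin 3) : ℕ := ∑ k, posSum (cls c 32 k)

theorem cls_subset (c : ℕ → Fin 3) (n : ℕ) (k : Fin 3) : cls c n k ⊆ Finset.range n :=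
  Finset.filter_subset _ _

theorem cls_subset_of_le (c : ℕ → Fin 3) {n : ℕ} (hn : n ≤ 32) (k : Fin 3) :
    cls c n k ⊆ Finset.range 32 :=
  (cls_subset c n k).trans (Finset.range_subset_range.2 hn)

theorem cls_succ_self (c : ℕ → Fin 3) (n : ℕ) : cls c (n + 1) (c n) = insert n (cls c n (c n)) := by
  simp [cls, Finset.range_add_one, Finset.filter_insert]

theorem cls_succ_of_ne {c : ℕ → Fin 3} {n : ℕ} {k : Fin 3} (h : c n ≠ k) :
    cls c (n + 1) k = cls c n k := by
  simp [cls, Finset.range_add_one, Finset.filter_insert, h]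

theorem cls_eq_union {c : ℕ → Fin 3} {n t : ℕ} {k : Fin 3} (hnt : n ≤ t)
    (h : ∀ i, n ≤ i → i < t → c i = k) : cls c t k = cls c n k ∪ Finset.Ico n t := by
  ext x
  simp only [cls, Finset.mem_filter, Finset.mem_range, Finset.mem_union, Finset.mem_Ico]
  constructor
  · rintro ⟨h1, h2⟩
    rcases lt_or_ge x n with h3 | h3
    exacts [Or.inl ⟨h3, h2⟩, Or.inr ⟨h3, h1⟩]
  · rintro (⟨h1, h2⟩ | ⟨h1, h2⟩)
    exacts [⟨h1.trans_le hnt, h2⟩, ⟨h2, h x h1 h2⟩]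

theorem cls_eq_of_ne {c : ℕ → Fin 3} {n t : ℕ} {k : Fin 3} (hnt : n ≤ t)
    (h : ∀ i, n ≤ i → i < t → c i ≠ k) : cls c t k = cls c n k := by
  ext x
  simp only [cls, Finset.mem_filter, Finset.mem_range]
  constructor
  · rintro ⟨h1, h2⟩
    rcases lt_or_ge x n with h3 | h3
    exacts [⟨h3, h2⟩, absurd h2 (h x h3 h1)]
  · rintro ⟨h1, h2⟩
    exact ⟨h1.trans_le hnt, h2⟩

theorem sum_fin_three {a b d : Fin 3} (h1 : a ≠ b) (h2 : a ≠ d) (h3 : b ≠ d) (g : Fin 3 → ℕ) :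
    ∑ k, g k = g a + g b + g d := by
  rw [Fin.sum_univ_three]
  fin_cases a <;> fin_cases b <;> fin_cases d <;> simp_all <;> omega

theorem eq_or_eq_or_eq {a b d : Fin 3} (h1 : a ≠ b) (h2 : a ≠ d) (h3 : b ≠ d) (e : Fin 3) :
    e = a ∨ e = b ∨ e = d := by
  revert a b d e
  decide

theorem sum_posSum_cls_succ_le (c : ℕ → Fin 3) {n : ℕ} (hn : n < 32) :
    ∑ k, posSum (cls c (n + 1) k) ≤ ∑ k, posSum (cls c n k) + 56 := by
  rw [← Finset.add_sum_erase _ _ (Finset.mem_univ (c n)),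
    ← Finset.add_sum_erase _ (fun k => posSum (cls c n k)) (Finset.mem_univ (c n)), cls_succ_self]
  have h1 := posSum_insert_le (cls c n (c n)) hn
  have h2 : ∑ k ∈ Finset.univ.erase (c n), posSum (cls c (n + 1) k) =
      ∑ k ∈ Finset.univ.erase (c n), posSum (cls c n k) :=
    Finset.sum_congr rfl fun k hk => by rw [cls_succ_of_ne (Finset.ne_of_mem_erase hk).symm]
  omega

theorem total_le (c : ℕ → Fin 3) {m : ℕ} (hm : m ≤ 32) :
    total c ≤ ∑ k, posSum (cls c (32 - m) k) + 56 * m := by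
  induction m with
  | zero => simp [total]
  | succ m ih =>
    have h1 := ih (by omega)
    have h2 := sum_posSum_cls_succ_le c (n := 32 - (m + 1)) (by omega)
    rw [show 32 - (m + 1) + 1 = 32 - m by omega] at h2
    omega

theorem changes_of_ne {c : ℕ → Fin 3} {n : ℕ} (hn : n < 31) (h : c n ≠ c (n + 1)) :
    changes c n = changes c (n + 1) + 1 := by
  rw [changes, ← Finset.insert_Ico_add_one_left_eq_Ico hn, Finset.filter_insert, if_pos h,
    Finset.card_insert_of_notMem (by simp), changes]

theorem changes_of_eq {c : ℕ → Fin 3} {n : ℕ} (hn : n < 31) (h : c n = c (n + 1)) :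
    changes c n = changes c (n + 1) := by
  rw [changes, ← Finset.insert_Ico_add_one_left_eq_Ico hn, Finset.filter_insert,
    if_neg (not_not.2 h), changes]

theorem changes_mono (c : ℕ → Fin 3) {m n : ℕ} (h : m ≤ n) : changes c n ≤ changes c m :=
  Finset.card_le_card (Finset.filter_subset_filter _ (Finset.Ico_subset_Ico_left h))

theorem eq_of_changes_eq_zero {c : ℕ → Fin 3} {n : ℕ} (hn : n ≤ 31) (h : changes c n = 0) {i : ℕ}
    (hi : n ≤ i) (hi' : i ≤ 31) : c i = c 31 := by
  induction hn using Nat.decreasingInduction generalizing i with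
  | self => rw [show i = 31 by omega]
  | of_succ n hn ih =>
    by_cases he : c n = c (n + 1)
    · rw [changes_of_eq hn he] at h
      rcases hi.eq_or_lt with rfl | hlt
      · rw [he, ih h le_rfl hn]
      · exact ih h hlt hi'
    · rw [changes_of_ne hn he] at h
      omega

/-- At most one change leaves at most two runs, the second starting at `t`; `t = 32` allows for an
empty second run. -/
theorem exists_switch {c : ℕ → Fin 3} {n : ℕ} (hn : n ≤ 31) (h : changes c n ≤ 1) :
    ∃ t, n < t ∧ t ≤ 32 ∧ (∀ i, n ≤ i → i < t → c i = c n) ∧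
      ∀ i, t ≤ i → i ≤ 31 → c i = c 31 := by
  induction hn using Nat.decreasingInduction with
  | self => exact ⟨32, by omega, le_rfl, fun i h1 h2 => by rw [show i = 31 by omega], by omega⟩
  | of_succ n hn ih =>
    by_cases he : c n = c (n + 1)
    · obtain ⟨t, h1, h2, h3, h4⟩ := ih (by rwa [changes_of_eq hn he] at h)
      refine ⟨t, by omega, h2, fun i hi hi' => ?_, h4⟩
      rcases hi.eq_or_lt with rfl | hlt
      · rfl
      · rw [h3 i hlt hi', he]
    · rw [changes_of_ne hn he] at h
      refine ⟨n + 1, by omega, by omega, fun i hi hi' => by rw [show i = n by omega],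
        fun i hi hi' => eq_of_changes_eq_zero (n := n + 1) hn (by omega) hi hi'⟩

/-! ### Correctness of the search -/

section

variable {hi m F U V : ℕ} {row : Row} {rows : List Row} {on off : Search}

/-- The packed vector `x` after the input described by `row` has been added. -/
def Row.addTo (row : Row) (x : ℕ) : ℕ := Nat.sub (Nat.add x row.pos) row.neg

def Row.fillTo (row : Row) (x : ℕ) : ℕ := Nat.sub (Nat.add x row.sufPos) row.sufNeg

theorem addRow_eq (x : ℕ) (row : Row) (k : ℕ → Bool) : addRow x row k = k (row.addTo x) :=
  force_eq _ _

theorem boolRec_false {x y : Bool} (h : (Bool.rec false x y : Bool) = true) :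
    x = true ∧ y = true := by
  cases y
  · exact absurd h (by simp)
  · exact ⟨h, rfl⟩

theorem boolRec_true {x y : Bool} (h : (Bool.rec x true y : Bool) = true) :
    y = true ∨ x = true := by
  cases y
  · exact Or.inr h
  · exact Or.inl rfl

theorem on0_nil (h : on0 hi [] F U V = true) : value hi F U V ≤ 1044 := Nat.le_of_ble_eq_true h

theorem on0_cons (h : on0 hi (row :: rows) F U V = true) :
    value hi (row.fillTo F) U V ≤ 1044 := Nat.le_of_ble_eq_true h

theorem scan_zero_cons (h : scan hi (row :: rows) 0 U V F = true) :
    value hi U V (row.fillTo F) ≤ 1044 ∧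
      scan hi rows ((1044 - value hi U V (row.fillTo F)) / 112) (row.addTo U) V F = true := by
  have h' : force (value hi U V (row.fillTo F)) (fun v => Bool.rec false
      (addRow U row fun U' => scan hi rows (Nat.div (Nat.sub 1044 v) 112) U' V F)
      (Nat.ble v 1044)) = true := h
  rw [force_eq] at h'
  obtain ⟨h1, h2⟩ := boolRec_false h'
  rw [addRow_eq] at h1
  exact ⟨Nat.le_of_ble_eq_true h2, h1⟩

theorem scan_succ_cons {s : ℕ} (h : scan hi (row :: rows) (s + 1) U V F = true) :
    scan hi rows s (row.addTo U) V F = true := by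
  have h' : addRow U row (fun U' => scan hi rows s U' V F) = true := h
  rwa [addRow_eq] at h'

theorem mkOn_nil (h : mkOn hi off [] F U V = true) : value hi F U V ≤ 1044 :=
  Nat.le_of_ble_eq_true h

theorem mkOn_cons (h : mkOn hi off (row :: rows) F U V = true) :
    value hi F U V + row.rest ≤ 1044 ∨ (mkOn hi off rows (row.addTo F) U V = true ∧
      off rows (row.addTo U) V F = true ∧ off rows (row.addTo V) U F = true) := by
  rcases boolRec_true h with h | h
  · exact Or.inl (Nat.le_of_ble_eq_true h)
  · obtain ⟨h, h1⟩ := boolRec_false h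
    obtain ⟨h3, h2⟩ := boolRec_false h
    rw [addRow_eq] at h1 h2 h3
    exact Or.inr ⟨h1, h2, h3⟩

theorem mkOff_cons (h : mkOff hi on off (row :: rows) U V F = true) :
    value hi U V F + row.rest ≤ 1044 ∨ (mkOff hi on off rows (row.addTo U) V F = true ∧
      off rows (row.addTo V) U F = true ∧ on rows (row.addTo F) U V = true) := by
  rcases boolRec_true h with h | h
  · exact Or.inl (Nat.le_of_ble_eq_true h)
  · obtain ⟨h, h1⟩ := boolRec_false h
    obtain ⟨h2, h3⟩ := boolRec_false h
    rw [addRow_eq] at h1 h2 h3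
    exact Or.inr ⟨h1, h2, h3⟩

theorem afterRun_succ_cons {k : List Row → ℕ → Bool} {L : ℕ}
    (h : afterRun k (L + 1) (row :: rows) U = true) : afterRun k L rows (row.addTo U) = true := by
  have h' : addRow U row (fun U' => afterRun k L rows U') = true := h
  rwa [addRow_eq] at h'

theorem afterFirstChange_cons (h : afterFirstChange hi (row :: rows) U = true) :
    (searches hi 3).2 rows (row.addTo hi) U hi = true ∧
      (searches hi 3).1 rows (row.addTo hi) U hi = true := by
  have h' : (Bool.rec false (addRow hi row fun V => (searches hi 3).2 rows V U hi)
    (addRow hi row fun F => (searches hi 3).1 rows F U hi) : Bool) = true := h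
  obtain ⟨h1, h2⟩ := boolRec_false h'
  rw [addRow_eq] at h1 h2
  exact ⟨h1, h2⟩

theorem searches_succ (k : ℕ) : searches hi (k + 1) =
    (mkOn hi (searches hi k).2, mkOff hi (searches hi k).1 (searches hi k).2) := rfl

/-- The row of the first among the last `m + 1` inputs. -/
def rowOf (m : ℕ) : Row := ⟨posRow (31 - m), negRow (31 - m), suffixSum posRow (m + 1),
  suffixSum negRow (m + 1), 56 * (m + 1)⟩

theorem lastRows_succ : lastRows (m + 1) = rowOf m :: lastRows m := rfl

theorem rest_rowOf : (rowOf m).rest = 56 * (m + 1) := rfl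

theorem addTo_rowOf (x : ℕ) :
    (rowOf m).addTo x = Nat.sub (Nat.add x (posRow (31 - m))) (negRow (31 - m)) := rfl

theorem fillTo_rowOf (x : ℕ) : (rowOf m).fillTo x =
    Nat.sub (Nat.add x (suffixSum posRow (m + 1))) (suffixSum negRow (m + 1)) := rfl

end

/-- `s` finds all strategies that are in the message `a = c 31` at the last of the inputs that have
been read, and have at most `k` changes left. -/
def OnSound (k : ℕ) (s : Search) : Prop :=
  ∀ (c : ℕ → Fin 3) (m F U V : ℕ) (a b d : Fin 3), m ≤ 31 → a ≠ b → a ≠ d → b ≠ d →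
    c (31 - m) = a → c 31 = a → changes c (31 - m) ≤ k →
    Rep F (cls c (32 - m) a) → Rep U (cls c (32 - m) b) → Rep V (cls c (32 - m) d) →
    s (lastRows m) F U V = true → total c ≤ 1044

/-- `s` finds all strategies that are in the message `a ≠ c 31` at the last of the inputs that have
been read, and have at most `k` changes left. -/
def OffSound (k : ℕ) (s : Search) : Prop :=
  ∀ (c : ℕ → Fin 3) (m U V F : ℕ) (a b d : Fin 3), m ≤ 31 → a ≠ b → a ≠ d → b ≠ d →
    c (31 - m) = a → c 31 = d → changes c (31 - m) ≤ k →
    Rep U (cls c (32 - m) a) → Rep V (cls c (32 - m) b) → Rep F (cls c (32 - m) d) →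
    s (lastRows m) U V F = true → total c ≤ 1044

section

variable {c : ℕ → Fin 3} {n : ℕ} {a b d : Fin 3} {X Y Z : ℕ}

theorem value_cls (hn : n ≤ 32) (h1 : a ≠ b) (h2 : a ≠ d) (h3 : b ≠ d)
    (hX : Rep X (cls c n a)) (hY : Rep Y (cls c n b)) (hZ : Rep Z (cls c n d)) :
    value bias X Y Z = ∑ k, posSum (cls c n k) := by
  rw [value_eq hX hY hZ (cls_subset_of_le c hn _) (cls_subset_of_le c hn _)
    (cls_subset_of_le c hn _), sum_fin_three h1 h2 h3 fun k => posSum (cls c n k)]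

theorem total_le_of_prune {m : ℕ} (hm : m ≤ 32) (h1 : a ≠ b) (h2 : a ≠ d) (h3 : b ≠ d)
    (hX : Rep X (cls c (32 - m) a)) (hY : Rep Y (cls c (32 - m) b))
    (hZ : Rep Z (cls c (32 - m) d))
    (h : value bias X Y Z + 56 * m ≤ 1044) : total c ≤ 1044 := by
  rw [value_cls (by omega) h1 h2 h3 hX hY hZ] at h
  exact (total_le c hm).trans h

theorem Rep.step (h : Rep X (cls c n a)) (hn : n < 32) (hc : c n = a) :
    Rep (Nat.sub (Nat.add X (posRow n)) (negRow n)) (cls c (n + 1) a) := by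
  subst hc
  rw [cls_succ_self]
  exact h.insert hn (cls_subset c n _)

theorem Rep.stay (h : Rep X (cls c n a)) (hc : c n ≠ a) : Rep X (cls c (n + 1) a) := by
  rwa [cls_succ_of_ne hc]

end

/-- A single change cannot end in the message it leaves. With at most one change left and the final
message already reached, there is none, and all remaining inputs are added at once. Hence the bound
1 and not 0. -/
theorem on0_sound : OnSound 1 (on0 bias) := by
  intro c m F U V a b d hm hab had hbd hcur hfin hch hF hU hV hs
  have hall : ∀ i, 32 - m ≤ i → i < 32 → c i = a := by
    obtain ⟨t, -, -, h1, h2⟩ := exists_switch (by omega) hch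
    intro i hi hi'
    rcases lt_or_ge i t with h | h
    · rw [h1 i (by omega) h, hcur]
    · rw [h2 i h (by omega), hfin]
  have ea : cls c 32 a = cls c (32 - m) a ∪ Finset.Ico (32 - m) 32 :=
    cls_eq_union (by omega) hall
  have eb : cls c 32 b = cls c (32 - m) b :=
    cls_eq_of_ne (by omega) fun i h h' => by rwa [hall i h h']
  have ed : cls c 32 d = cls c (32 - m) d :=
    cls_eq_of_ne (by omega) fun i h h' => by rwa [hall i h h']
  rw [← eb] at hU
  rw [← ed] at hV
  cases m with
  | zero =>
    have h := on0_nil hs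
    rwa [value_cls le_rfl hab had hbd hF hU hV] at h
  | succ m =>
    rw [lastRows_succ] at hs
    have h := on0_cons hs
    have hF' := hF.fill (by omega) (cls_subset c _ _)
    rw [← ea, ← fillTo_rowOf] at hF'
    rwa [value_cls le_rfl hab had hbd hF' hU hV] at h

/-- Delaying the last change by one input moves this input from the final message to the current
one, which raises the value by at most 56 + 56 = 112. A value `v` therefore also settles the next
`(1044 - v) / 112` positions of the change. -/
theorem scan_true {m : ℕ} (hm : m ≤ 32) {s t U V F : ℕ} {A B D : Finset ℕ}
    (hA : A ⊆ Finset.range (32 - m)) (hB : B ⊆ Finset.range (32 - m))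
    (hD : D ⊆ Finset.range (32 - m)) (hU : Rep U A) (hV : Rep V B) (hF : Rep F D)
    (hst : 32 - m + s ≤ t) (ht : t ≤ 31) (h : scan bias (lastRows m) s U V F = true) :
    posSum (A ∪ Finset.Ico (32 - m) t) + posSum B + posSum (D ∪ Finset.Ico t 32) ≤ 1044 := by
  induction m generalizing s U A with
  | zero => omega
  | succ m ih =>
    have hx : 31 - m = 32 - (m + 1) := by omega
    have hsub : ∀ {S : Finset ℕ}, S ⊆ Finset.range (32 - (m + 1)) → S ⊆ Finset.range (32 - m) :=
      fun h => h.trans (Finset.range_subset_range.2 (by omega))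
    have hU' : Rep ((rowOf m).addTo U) (insert (31 - m) A) := hU.insert (by omega) (by rwa [hx])
    have hA' : insert (31 - m) A ⊆ Finset.range (32 - m) :=
      Finset.insert_subset (by simp; omega) (hsub hA)
    have hunion : 32 - m ≤ t → insert (31 - m) A ∪ Finset.Ico (32 - m) t =
        A ∪ Finset.Ico (32 - (m + 1)) t := fun hmt => by
      rw [← hx, ← Finset.insert_Ico_add_one_left_eq_Ico (a := 31 - m) (by omega),
        show 31 - m + 1 = 32 - m by omega, Finset.insert_union, Finset.union_insert]
    rw [lastRows_succ] at h
    cases s with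
    | succ s =>
      have := ih (by omega) hA' (hsub hB) (hsub hD) hU' (s := s) (by omega) (scan_succ_cons h)
      rwa [hunion (by omega)] at this
    | zero =>
      obtain ⟨hle, h2⟩ := scan_zero_cons h
      have r32 : ∀ {n : ℕ}, n ≤ 32 → Finset.range n ⊆ Finset.range 32 :=
        fun h => Finset.range_subset_range.2 h
      have hF' := hF.fill hm hD
      rw [← fillTo_rowOf] at hF'
      have hv := value_eq hU hV hF' (hA.trans (r32 (by omega))) (hB.trans (r32 (by omega)))
        (Finset.union_subset (hD.trans (r32 (by omega)))
          (fun x hx => by simp at hx ⊢; omega))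
      rw [hv] at hle h2
      set v := posSum A + posSum B + posSum (D ∪ Finset.Ico (32 - (m + 1)) 32)
      -- Either `t` is within the distance settled by `v`, or it survives the skip and the induction
      -- applies.
      rcases lt_or_ge t (32 - m + (1044 - v) / 112) with hlt | hge
      · have hIco : Finset.Ico (32 - (m + 1)) t ⊆ Finset.range 32 := fun x hx => by
          simp at hx ⊢
          omega
        have h3 := posSum_union_le A hIco
        have h4 := posSum_sdiff_le (D ∪ Finset.Ico (32 - (m + 1)) 32) hIco
        have e : (D ∪ Finset.Ico (32 - (m + 1)) 32) \ Finset.Ico (32 - (m + 1)) t =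
            D ∪ Finset.Ico t 32 := by
          ext x
          simp only [Finset.mem_sdiff, Finset.mem_union, Finset.mem_Ico]
          constructor
          · rintro ⟨h | h, h'⟩
            · exact Or.inl h
            · exact Or.inr ⟨by omega, h.2⟩
          · rintro (h | h)
            · have := Finset.mem_range.1 (hD h)
              exact ⟨Or.inl h, by omega⟩
            · exact ⟨Or.inr ⟨by omega, h.2⟩, by omega⟩
        rw [e] at h4
        rw [Nat.card_Ico] at h3 h4
        omega
      · have := ih (by omega) hA' (hsub hB) (hsub hD) hU' hge h2
        rwa [hunion (by omega)] at this

theorem scan_sound : OffSound 1 fun rows => scan bias rows 0 := by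
  intro c m U V F a b d hm hab had hbd hcur hfin hch hU hV hF hs
  obtain ⟨t, h0, h1, h2, h3⟩ := exists_switch (by omega) hch
  have ht : t ≤ 31 := by
    by_contra hlt
    exact had (by rw [← hcur, ← hfin, h2 31 (by omega) (by omega)])
  have key := scan_true (by omega) (cls_subset c _ _) (cls_subset c _ _) (cls_subset c _ _)
    hU hV hF (s := 0) (t := t) (by omega) ht hs
  have c1 : ∀ i, 32 - m ≤ i → i < t → c i = a := fun i h h' => by rw [h2 i (by omega) h', hcur]
  have c2 : ∀ i, t ≤ i → i < 32 → c i = d := fun i h h' => by rw [h3 i h (by omega), hfin]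
  have ea : cls c 32 a = cls c (32 - m) a ∪ Finset.Ico (32 - m) t := by
    rw [cls_eq_of_ne h1 fun i h h' => by rw [c2 i h h']; exact had.symm,
      cls_eq_union (by omega) c1]
  have eb : cls c 32 b = cls c (32 - m) b := by
    rw [cls_eq_of_ne h1 fun i h h' => by rw [c2 i h h']; exact hbd.symm,
      cls_eq_of_ne (n := 32 - m) (by omega) fun i h h' => by rw [c1 i h h']; exact hab]
  have ed : cls c 32 d = cls c (32 - m) d ∪ Finset.Ico t 32 := by
    rw [cls_eq_union h1 c2,
      cls_eq_of_ne (n := 32 - m) (by omega) fun i h h' => by rw [c1 i h h']; exact had]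
  rwa [total, sum_fin_three hab had hbd fun k => posSum (cls c 32 k), ea, eb, ed]

/-- Unless the branch is pruned, the next input either keeps the message or spends a change on one
of the two others, which are then not final. -/
theorem mkOn_sound {k : ℕ} {off : Search} (hoff : OffSound k off) :
    OnSound (k + 1) (mkOn bias off) := by
  intro c m F U V a b d hm hab had hbd hcur hfin hch hF hU hV hs
  induction m generalizing F U V with
  | zero =>
    exact total_le_of_prune (m := 0) (by omega) hab had hbd hF hU hV (mkOn_nil hs)
  | succ m ih =>
    rw [lastRows_succ] at hs
    rcases mkOn_cons hs with h | ⟨hstay, hb, hd⟩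
    · rw [rest_rowOf] at h
      exact total_le_of_prune (by omega) hab had hbd hF hU hV h
    rw [addTo_rowOf] at hstay hd hb
    have e1 : 31 - (m + 1) + 1 = 31 - m := by omega
    have e2 : 32 - (m + 1) = 31 - m := by omega
    have e3 : 31 - m + 1 = 32 - m := by omega
    rw [e2] at hF hU hV
    rcases eq_or_eq_or_eq hab had hbd (c (31 - m)) with h | h | h
    · refine ih _ _ _ (by omega) h ((changes_mono c (by omega)).trans hch) ?_ ?_ ?_ hstay
      · exact e3 ▸ hF.step (by omega) h
      · exact e3 ▸ hU.stay (by rwa [h])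
      · exact e3 ▸ hV.stay (by rwa [h])
    · have hne : c (31 - (m + 1)) ≠ c (31 - (m + 1) + 1) := by rwa [e1, hcur, h]
      rw [changes_of_ne (by omega) hne, e1] at hch
      refine hoff c m _ V F b d a (by omega) hbd hab.symm had.symm h hfin (by omega) ?_ ?_ ?_ hb
      · exact e3 ▸ hU.step (by omega) h
      · exact e3 ▸ hV.stay (by rwa [h])
      · exact e3 ▸ hF.stay (by rw [h]; exact hab.symm)
    · have hne : c (31 - (m + 1)) ≠ c (31 - (m + 1) + 1) := by rwa [e1, hcur, h]
      rw [changes_of_ne (by omega) hne, e1] at hch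
      refine hoff c m _ U F d b a (by omega) hbd.symm had.symm hab.symm h hfin (by omega)
        ?_ ?_ ?_ hd
      · exact e3 ▸ hV.step (by omega) h
      · exact e3 ▸ hU.stay (by rw [h]; exact hbd.symm)
      · exact e3 ▸ hF.stay (by rw [h]; exact had.symm)

theorem mkOff_sound {k : ℕ} {on off : Search} (hon : OnSound k on) (hoff : OffSound k off) :
    OffSound (k + 1) (mkOff bias on off) := by
  intro c m U V F a b d hm hab had hbd hcur hfin hch hU hV hF hs
  induction m generalizing F U V with
  -- With no input left the current message is the final one, so the answer `true` on the empty list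
  -- is harmless.
  | zero => exact absurd (hcur.symm.trans hfin) had
  | succ m ih =>
    rw [lastRows_succ] at hs
    rcases mkOff_cons hs with h | ⟨hstay, hb, hd⟩
    · rw [rest_rowOf] at h
      exact total_le_of_prune (by omega) hab had hbd hU hV hF h
    rw [addTo_rowOf] at hstay hd hb
    have e1 : 31 - (m + 1) + 1 = 31 - m := by omega
    have e2 : 32 - (m + 1) = 31 - m := by omega
    have e3 : 31 - m + 1 = 32 - m := by omega
    rw [e2] at hF hU hV
    rcases eq_or_eq_or_eq hab had hbd (c (31 - m)) with h | h | h
    · refine ih _ _ _ (by omega) h ((changes_mono c (by omega)).trans hch) ?_ ?_ ?_ hstay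
      · exact e3 ▸ hU.step (by omega) h
      · exact e3 ▸ hV.stay (by rwa [h])
      · exact e3 ▸ hF.stay (by rwa [h])
    · have hne : c (31 - (m + 1)) ≠ c (31 - (m + 1) + 1) := by rwa [e1, hcur, h]
      rw [changes_of_ne (by omega) hne, e1] at hch
      refine hoff c m _ U F b a d (by omega) hab.symm hbd had h hfin (by omega) ?_ ?_ ?_ hb
      · exact e3 ▸ hV.step (by omega) h
      · exact e3 ▸ hU.stay (by rw [h]; exact hab.symm)
      · exact e3 ▸ hF.stay (by rwa [h])
    · have hne : c (31 - (m + 1)) ≠ c (31 - (m + 1) + 1) := by rwa [e1, hcur, h]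
      rw [changes_of_ne (by omega) hne, e1] at hch
      refine hon c m _ U V d a b (by omega) had.symm hbd.symm hab h hfin (by omega) ?_ ?_ ?_ hd
      · exact e3 ▸ hF.step (by omega) h
      · exact e3 ▸ hU.stay (by rw [h]; exact had.symm)
      · exact e3 ▸ hV.stay (by rw [h]; exact hbd.symm)

theorem searches_sound (k : ℕ) :
    OnSound (k + 1) (searches bias k).1 ∧ OffSound (k + 1) (searches bias k).2 := by
  induction k with
  | zero => exact ⟨on0_sound, scan_sound⟩
  | succ k ih =>
    rw [searches_succ]
    exact ⟨mkOn_sound ih.2, mkOff_sound ih.1 ih.2⟩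

theorem afterRun_true {k : List Row → ℕ → Bool} {L m U : ℕ} (hL : L ≤ m) (hm : m ≤ 32)
    (hU : Rep U (Finset.range (32 - m))) (h : afterRun k L (lastRows m) U = true) :
    ∃ U', Rep U' (Finset.range (32 - (m - L))) ∧ k (lastRows (m - L)) U' = true := by
  induction L generalizing m U with
  | zero => exact ⟨U, hU, h⟩
  | succ L ih =>
    obtain ⟨m, rfl⟩ : ∃ m', m = m' + 1 := ⟨m - 1, by omega⟩
    rw [lastRows_succ] at h
    have h' := afterRun_succ_cons h
    rw [addTo_rowOf] at h'
    rw [show m + 1 - (L + 1) = m - L by omega]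
    refine ih (by omega) (by omega) ?_ h'
    have := hU.insert (x := 31 - m) (by omega) (by rw [show 32 - (m + 1) = 31 - m by omega])
    rwa [show 32 - (m + 1) = 31 - m by omega, ← Finset.range_add_one,
      show 31 - m + 1 = 32 - m by omega] at this

/-- After the first run the two other messages are unused and thus interchangeable. As the final
message is not the first one, only one distinction remains: whether the second run is already in the
final message. -/
theorem total_le_of_check {c : ℕ → Fin 3} {L : ℕ} (hL : 1 ≤ L) (hL' : L ≤ 31)
    (hrun : ∀ i < L, c i = c 0) (hc : c L ≠ c 0) (h31 : c 31 ≠ c 0) (hch : changes c L ≤ 4)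
    (h : check L = true) : total c ≤ 1044 := by
  rw [check, force_eq, forceRows_eq] at h
  obtain ⟨U, hU, h⟩ := afterRun_true (by omega) le_rfl (by simpa using rep_bias) h
  obtain ⟨m, hm⟩ : ∃ m, 32 - L = m + 1 := ⟨31 - L, by omega⟩
  have hLm : L = 31 - m := by omega
  rw [hm] at h hU
  rw [lastRows_succ] at h
  obtain ⟨h1, h2⟩ := afterFirstChange_cons h
  rw [addTo_rowOf] at h1 h2
  have e0 : cls c (31 - m) (c 0) = Finset.range (31 - m) :=
    Finset.filter_true_of_mem fun i hi => hrun i (by have := Finset.mem_range.1 hi; omega)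
  have e1 : ∀ k, k ≠ c 0 → cls c (31 - m) k = ∅ := fun k hk =>
    Finset.filter_false_of_mem fun i hi => by
      rw [hrun i (by have := Finset.mem_range.1 hi; omega)]
      exact hk.symm
  have hb : ∀ k, k ≠ c 0 → Rep bias (cls c (31 - m) k) := fun k hk => by
    rw [e1 k hk]
    exact rep_bias
  rw [show 32 - (m + 1) = 31 - m by omega, ← e0] at hU
  have e3 : 31 - m + 1 = 32 - m := by omega
  rw [hLm] at hc hch
  by_cases hcase : c (31 - m) = c 31
  · obtain ⟨d, hd1, hd2⟩ : ∃ d : Fin 3, d ≠ c 0 ∧ d ≠ c 31 :=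
      (by decide : ∀ x y : Fin 3, ∃ d : Fin 3, d ≠ x ∧ d ≠ y) _ _
    refine (searches_sound 3).1 c m _ U bias (c 31) (c 0) d (by omega) h31 hd2.symm hd1.symm hcase
      rfl hch ?_ ?_ ?_ h2
    · exact e3 ▸ (hb _ h31).step (by omega) hcase
    · exact e3 ▸ hU.stay hc
    · exact e3 ▸ (hb d hd1).stay (by rw [hcase]; exact hd2.symm)
  · refine (searches_sound 3).2 c m _ U bias (c (31 - m)) (c 0) (c 31) (by omega) hc hcase h31.symm
      rfl rfl hch ?_ ?_ ?_ h1
    · exact e3 ▸ (hb _ hc).step (by omega) rfl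
    · exact e3 ▸ hU.stay hc
    · exact e3 ▸ (hb _ h31).stay hcase

end SectionSearch

namespace SectionSearch

/-! ### Colorings of the cycle -/

/-- The witness as a function on `ℤ/32`. -/
def wit (t : Fin 32) : ℤ := (weight t.val : ℤ) - weight (t + 16).val

theorem wt_eq_wit : ∀ x y : Fin 32, wt x.val y.val = wit (x - y) := by decide +kernel

theorem wit_sub_sixteen : ∀ t : Fin 32, wit (t - 16) = -wit t := by decide +kernel

def corr (c : Fin 32 → Fin 3) (k : Fin 3) (y : Fin 32) : ℤ :=
  ∑ x, if c x = k then wit (x - y) else 0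

def cyclicTotal (c : Fin 32 → Fin 3) : ℕ := ∑ k, ∑ y, (corr c k y).toNat

theorem total_eq_cyclicTotal (c : Fin 32 → Fin 3) :
    total (fun i => c (Fin.ofNat 32 i)) = cyclicTotal c := by
  refine Finset.sum_congr rfl fun k _ => ?_
  rw [posSum, Finset.sum_range]
  refine Finset.sum_congr rfl fun y _ => ?_
  rw [vec, cls, Finset.sum_filter, Finset.sum_range, corr]
  congr 1
  refine Finset.sum_congr rfl fun x _ => ?_
  rw [show Fin.ofNat 32 x.val = x from Fin.ext (Nat.mod_eq_of_lt x.isLt), wt_eq_wit]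

theorem cyclicTotal_shift (c : Fin 32 → Fin 3) (s : Fin 32) :
    cyclicTotal (fun i => c (s + i)) = cyclicTotal c := by
  refine Finset.sum_congr rfl fun k _ => ?_
  rw [← Equiv.sum_comp (Equiv.addLeft s) fun y => (corr c k y).toNat]
  refine Finset.sum_congr rfl fun y _ => ?_
  congr 1
  rw [corr, corr, ← Equiv.sum_comp (Equiv.addLeft s)
    fun x => if c x = k then wit (x - Equiv.addLeft s y) else 0]
  refine Finset.sum_congr rfl fun x _ => ?_
  simp only [Equiv.coe_addLeft, add_sub_add_left_eq_sub]

theorem sum_wit_sub : ∀ y : Fin 32, ∑ x, wit (x - y) = 0 := by decide +kernel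

theorem cyclicTotal_const (a : Fin 3) : cyclicTotal (fun _ => a) = 0 := by
  refine Finset.sum_eq_zero fun k _ => Finset.sum_eq_zero fun y _ => ?_
  rw [corr]
  by_cases h : a = k
  · simp only [h, if_true, sum_wit_sub, Int.toNat_zero]
  · simp [h]

/-- If at most `6` of the `32` points of a cycle are marked, one of them is followed by `5` points
that are not. -/
theorem exists_gap {S : Finset (Fin 32)} (hne : S.Nonempty) (hS : S.card ≤ 6) :
    ∃ s ∈ S, ∀ j ∈ Finset.Icc (1 : ℕ) 5, s + Fin.ofNat 32 j ∉ S := by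
  by_contra! h
  have hofNat : ∀ i j : ℕ, Fin.ofNat 32 (i + j) = Fin.ofNat 32 i + Fin.ofNat 32 j := fun i j => by
    ext
    simp [Fin.add_def]
  obtain ⟨s₀, hs₀⟩ := hne
  -- If every marked point had another one among its five successors, the set `T` of points one to
  -- five steps after a marked point would be closed under successors, hence everything. But it has
  -- at most 6 · 5 = 30 elements.
  set T := S.biUnion fun s => (Finset.Icc (1 : ℕ) 5).image fun j => s + Fin.ofNat 32 j with hT
  have mem_T : ∀ x, x ∈ T ↔ ∃ s ∈ S, ∃ j, (1 ≤ j ∧ j ≤ 5) ∧ s + Fin.ofNat 32 j = x := by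
    simp [hT]
  have step : ∀ x ∈ T, x + Fin.ofNat 32 1 ∈ T := by
    intro x hx
    obtain ⟨s, hs, j, hj, rfl⟩ := (mem_T x).1 hx
    rcases lt_or_ge j 5 with hj5 | hj5
    · exact (mem_T _).2 ⟨s, hs, j + 1, by omega, by rw [hofNat, add_assoc]⟩
    · obtain ⟨i, hi, hsi⟩ := h s hs
      rw [Finset.mem_Icc] at hi
      -- The point `s + 6` is reached from the marked point `s + i` in `6 - i` steps.
      refine (mem_T _).2 ⟨_, hsi, 6 - i, by omega, ?_⟩
      rw [add_assoc, add_assoc, ← hofNat, ← hofNat]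
      congr 2
      omega
  have all : ∀ n : ℕ, s₀ + Fin.ofNat 32 1 + Fin.ofNat 32 n ∈ T := by
    intro n
    induction n with
    | zero => exact (mem_T _).2 ⟨s₀, hs₀, 1, by omega, (add_zero _).symm⟩
    | succ n ih =>
      rw [hofNat n 1, ← add_assoc]
      exact step _ ih
  have univ : T = Finset.univ := by
    refine Finset.eq_univ_of_forall fun x => ?_
    have := all (x - (s₀ + Fin.ofNat 32 1)).val
    rwa [show Fin.ofNat 32 (x - (s₀ + Fin.ofNat 32 1)).val = x - (s₀ + Fin.ofNat 32 1) from
      Fin.ext (Nat.mod_eq_of_lt (Fin.isLt _)), add_sub_cancel] at this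
  have card : T.card ≤ S.card * 5 := Finset.card_biUnion_le_card_mul _ _ _ fun s _ =>
    Finset.card_image_le.trans (by simp)
  rw [univ, Finset.card_univ, Fintype.card_fin] at card
  omega

theorem cyclicTotal_le {c : Fin 32 → Fin 3} (hc : gridSectionNumber c ≤ 6) :
    cyclicTotal c ≤ 1044 := by
  have hofNat : ∀ i j : ℕ, Fin.ofNat 32 (i + j) = Fin.ofNat 32 i + Fin.ofNat 32 j := fun i j => by
    ext
    simp [Fin.add_def]
  set S := Finset.univ.filter fun x : Fin 32 => c x ≠ c (x + 1) with hS
  have mem_S : ∀ x, x ∈ S ↔ c x ≠ c (x + 1) := by simp [hS]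
  have card_S : S.card ≤ 6 := hc
  rcases S.eq_empty_or_nonempty with hempty | hne
  · have const : ∀ n : ℕ, c (Fin.ofNat 32 n) = c 0 := by
      intro n
      induction n with
      | zero => rfl
      | succ n ih =>
        have : Fin.ofNat 32 n ∉ S := by simp [hempty]
        rw [mem_S, not_not] at this
        rw [hofNat, ← ih, this]
        rfl
    have : c = fun _ => c 0 := funext fun x => by
      rw [← const x.val, show Fin.ofNat 32 x.val = x from Fin.ext (Nat.mod_eq_of_lt x.isLt)]
    rw [this, cyclicTotal_const]
    omega
  obtain ⟨s, hs, hgap⟩ := exists_gap hne card_S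
  -- The rotated coloring starts right after the change at `s`, so that this change falls between 31
  -- and 0 and the first run has length at least 6.
  set e : ℕ → Fin 3 := fun i => c (s + 1 + Fin.ofNat 32 i) with he
  have e_ne : ∀ i, e i ≠ e (i + 1) ↔ s + 1 + Fin.ofNat 32 i ∈ S := fun i => by
    rw [mem_S, he]
    simp only [hofNat i 1, add_assoc]
    rfl
  have e31 : e 31 ≠ e 0 := by
    have h1 : s + 1 + Fin.ofNat 32 31 = s := by
      rw [add_assoc]
      exact add_zero s
    have h2 : s + 1 + Fin.ofNat 32 0 = s + 1 := add_zero _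
    rw [he]
    simp only [h1, h2]
    exact (mem_S s).1 hs
  have run : ∀ i < 6, e i = e 0 := by
    intro i hi
    induction i with
    | zero => rfl
    | succ i ih =>
      rw [← ih (by omega)]
      by_contra hne
      have h1 := (e_ne i).1 (Ne.symm hne)
      refine hgap (i + 1) (by simp; omega) ?_
      rw [add_comm i 1, hofNat, ← add_assoc]
      exact h1
  -- The change at `s` is the cyclic one and is not counted by `changes`.
  have hch : changes e 0 ≤ 5 := by
    have h1 : changes e 0 ≤ (S.erase s).card := by
      refine Finset.card_le_card_of_injOn (fun i => s + 1 + Fin.ofNat 32 i) ?_ ?_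
      · intro i hi
        simp only [Finset.coe_filter, Finset.mem_Ico, Set.mem_ofPred_eq] at hi
        refine Finset.mem_erase.2 ⟨fun h => ?_, (e_ne i).1 hi.2⟩
        replace h : s + 1 + Fin.ofNat 32 i = s := h
        rw [add_assoc, add_eq_left] at h
        have := congrArg Fin.val h
        simp [Fin.add_def] at this
        omega
      · intro i hi j hj h
        simp only [Finset.coe_filter, Finset.mem_Ico, Set.mem_ofPred_eq] at hi hj
        have := congrArg Fin.val (add_left_cancel h)
        simp at this
        omega
    rw [Finset.card_erase_of_mem hs] at h1
    omega
  have hex : ∃ L, e L ≠ e 0 := ⟨31, e31⟩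
  classical
  set L := Nat.find hex with hL
  have hL1 : e L ≠ e 0 := Nat.find_spec hex
  have hL2 : ∀ i < L, e i = e 0 := fun i hi => not_not.1 (Nat.find_min hex hi)
  have hL6 : 6 ≤ L := by
    by_contra hlt
    exact hL1 (run L (by omega))
  have hL31 : L ≤ 31 := Nat.find_min' hex e31
  -- The end of the first run uses up one more change.
  have hchL : changes e L ≤ 4 := by
    obtain ⟨M, hM⟩ : ∃ M, L = M + 1 := ⟨L - 1, by omega⟩
    have h1 := changes_of_ne (c := e) (n := M) (by omega)
      (by rw [← hM, hL2 M (by omega)]; exact hL1.symm)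
    have h2 := changes_mono e (Nat.zero_le M)
    rw [hM]
    omega
  have key := total_le_of_check (by omega) hL31 hL2 hL1 e31 hchL (check_eq_true hL6 hL31)
  rwa [he, total_eq_cyclicTotal (fun i => c (s + 1 + i)), cyclicTotal_shift] at key

theorem corr_add_sixteen (c : Fin 32 → Fin 3) (k : Fin 3) (y : Fin 32) :
    corr c k (y + 16) = -corr c k y := by
  rw [corr, corr, ← Finset.sum_neg_distrib]
  refine Finset.sum_congr rfl fun x _ => ?_
  rw [← sub_sub, wit_sub_sixteen]
  split_ifs <;> simp

/-- The entries at `y` and `y + 16` are opposite, so their positive parts add up to the absolute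
value. -/
theorem sum_abs_corr (c : Fin 32 → Fin 3) :
    ∑ y : Fin 16, ∑ k, |corr c k (y.castAdd 16)| = cyclicTotal c := by
  rw [cyclicTotal, Finset.sum_comm]
  push_cast
  refine Finset.sum_congr rfl fun k _ => ?_
  rw [Fin.sum_univ_add (a := 16) (b := 16) (fun y => ((corr c k y).toNat : ℤ)),
    ← Finset.sum_add_distrib]
  refine Finset.sum_congr rfl fun y _ => ?_
  rw [show Fin.natAdd 16 y = Fin.castAdd 16 y + 16 by revert y; decide, corr_add_sixteen]
  rcases abs_cases (corr c k (Fin.castAdd 16 y)) with h | h <;> omega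

end SectionSearch

/-! ### General facts on classical models -/

namespace ClassicalModel

variable {X Y : Type} {B : Y → Type} [∀ y, Fintype (B y)] {p : X → (y : Y) → B y → ℝ}
  {d : ℕ} {Λ : Type u} [MeasurableSpace Λ]

theorem dec_le_one (P : ClassicalModel p d Λ) (c : Fin d) (y : Y) (l : Λ) (b : B y) :
    P.dec c y l b ≤ 1 := by
  rw [← P.dec_sum c y l]
  exact Finset.single_le_sum (fun b _ => P.dec_nonneg c y l b) (Finset.mem_univ b)

theorem integrable_sum (P : ClassicalModel p d Λ) (x : X) (y : Y) (b : B y) :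
    Integrable (fun l => ∑ c, P.enc x l c * P.dec c y l b) P.prob := by
  have := P.isProbabilityMeasure
  refine Integrable.of_bound (C := 1) (Measurable.aestronglyMeasurable ?_)
    (Eventually.of_forall fun l => ?_)
  · exact Finset.measurable_sum _ fun c _ => (P.enc_measurable x c).mul (P.dec_measurable c y b)
  · rw [Real.norm_of_nonneg (Finset.sum_nonneg fun c _ =>
      mul_nonneg (P.enc_nonneg x l c) (P.dec_nonneg c y l b)), ← P.enc_sum x l]
    exact Finset.sum_le_sum fun c _ =>
      mul_le_of_le_one_right (P.enc_nonneg x l c) (P.dec_le_one c y l b)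

end ClassicalModel

/-! ### Two-outcome measurements -/

section

variable {X Y : Type} {p : X → Y → Fin 2 → ℝ} {d : ℕ} {Λ : Type u} [MeasurableSpace Λ]

/-- The expectation value of the outcome `±1` for the message `c`. -/
def ClassicalModel.expect (P : ClassicalModel (B := fun _ => Fin 2) p d Λ) (c : Fin d) (y : Y)
    (l : Λ) : ℝ := P.dec c y l 0 - P.dec c y l 1

theorem ClassicalModel.abs_expect_le (P : ClassicalModel (B := fun _ => Fin 2) p d Λ) (c : Fin d)
    (y : Y) (l : Λ) : |P.expect c y l| ≤ 1 := by
  have h0 := P.dec_nonneg c y l 0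
  have h1 := P.dec_nonneg c y l 1
  have h2 := P.dec_sum c y l
  rw [Fin.sum_univ_two] at h2
  rw [expect, abs_le]
  constructor <;> linarith

theorem ClassicalModel.integrable_expect (P : ClassicalModel (B := fun _ => Fin 2) p d Λ) (x : X)
    (y : Y) : Integrable (fun l => ∑ c, P.enc x l c * P.expect c y l) P.prob := by
  simp only [expect, mul_sub, Finset.sum_sub_distrib]
  exact (P.integrable_sum x y 0).sub (P.integrable_sum x y 1)

theorem ClassicalModel.integral_expect (P : ClassicalModel (B := fun _ => Fin 2) p d Λ) (x : X)
    (y : Y) : ∫ l, ∑ c, P.enc x l c * P.expect c y l ∂P.prob = p x y 0 - p x y 1 := by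
  rw [← P.simulates x y 0, ← P.simulates x y 1,
    ← integral_sub (P.integrable_sum x y 0) (P.integrable_sum x y 1)]
  simp only [expect, mul_sub, Finset.sum_sub_distrib]

/-- A linear functional of the correlations is bounded by its values on the strategies. -/
theorem ClassicalModel.sum_correlations_le [Fintype X] [Fintype Y]
    (P : ClassicalModel (B := fun _ => Fin 2) p d Λ) (w : X → Y → ℝ) (C : ℝ)
    (h : ∀ᵐ l ∂P.prob, ∑ y, ∑ x, w x y * ∑ c, P.enc x l c * P.expect c y l ≤ C) :
    ∑ y, ∑ x, w x y * (p x y 0 - p x y 1) ≤ C := by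
  have := P.isProbabilityMeasure
  have hint : ∀ y x, Integrable (fun l => w x y * ∑ c, P.enc x l c * P.expect c y l) P.prob :=
    fun y x => (P.integrable_expect x y).const_mul _
  calc ∑ y, ∑ x, w x y * (p x y 0 - p x y 1)
      = ∫ l, ∑ y, ∑ x, w x y * ∑ c, P.enc x l c * P.expect c y l ∂P.prob := by
        rw [integral_finsetSum _ fun y _ => integrable_finsetSum _ fun x _ => hint y x]
        refine Finset.sum_congr rfl fun y _ => ?_
        rw [integral_finsetSum _ fun x _ => hint y x]
        refine Finset.sum_congr rfl fun x _ => ?_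
        rw [integral_const_mul, P.integral_expect]
    _ ≤ ∫ _, C ∂P.prob := integral_mono_ae
        (integrable_finsetSum _ fun y _ => integrable_finsetSum _ fun x _ => hint y x)
        (integrable_const C) h
    _ = C := by simp

end

theorem trace_blochMatrix_mul (a b a' b' : ℝ) :
    (blochMatrix a b * blochMatrix a' b').trace = (1 + (a * a' + b * b')) / 2 := by
  rw [blochMatrix_eq, blochMatrix_eq]
  simp [Matrix.trace, Fin.sum_univ_two]
  ring

theorem bornProb_equator_sub (θ φ : ℝ) :
    bornProb (equatorState θ) (equatorMeasurement φ) 0 -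
      bornProb (equatorState θ) (equatorMeasurement φ) 1 = Real.cos (θ - φ) := by
  have h0 : bornProb (equatorState θ) (equatorMeasurement φ) 0 =
    (blochMatrix (Real.cos θ) (Real.sin θ) * blochMatrix (Real.cos φ) (Real.sin φ)).trace := rfl
  have h1 : bornProb (equatorState θ) (equatorMeasurement φ) 1 =
    (blochMatrix (Real.cos θ) (Real.sin θ) * blochMatrix (-Real.cos φ) (-Real.sin φ)).trace := rfl
  rw [h0, h1, trace_blochMatrix_mul, trace_blochMatrix_mul, Real.cos_sub]
  ring

/-! ### The grid setting -/

namespace SectionSearch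

theorem cos_three_pi_div_eight_bounds :
    0.3826 < Real.cos (3 * Real.pi / 8) ∧ Real.cos (3 * Real.pi / 8) < 0.3827 := by
  have hpi := Real.pi_pos
  have h0 : 0 < Real.cos (3 * Real.pi / 8) :=
    Real.cos_pos_of_mem_Ioo ⟨by linarith, by linarith⟩
  have h1 := Real.cos_sq (3 * Real.pi / 8)
  rw [show 2 * (3 * Real.pi / 8) = Real.pi - Real.pi / 4 by ring, Real.cos_pi_sub,
    Real.cos_pi_div_four] at h1
  have h2 : (1.4142 : ℝ) < √2 := Real.lt_sqrt_of_sq_lt (by norm_num)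
  have h3 : √2 < (1.4143 : ℝ) := (Real.sqrt_lt' (by norm_num)).2 (by norm_num)
  constructor <;> nlinarith

theorem lt_cos_five_pi_div_sixteen : 0.5555 < Real.cos (5 * Real.pi / 16) := by
  have hpi := Real.pi_pos
  have h0 : 0 < Real.cos (5 * Real.pi / 16) :=
    Real.cos_pos_of_mem_Ioo ⟨by linarith, by linarith⟩
  have h1 := Real.cos_sq (5 * Real.pi / 16)
  rw [show 2 * (5 * Real.pi / 16) = Real.pi - 3 * Real.pi / 8 by ring, Real.cos_pi_sub] at h1
  have h2 := cos_three_pi_div_eight_bounds.2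
  nlinarith

theorem wit_eq_zero : ∀ t : Fin 32,
    t ∉ ({0, 5, 6, 10, 11, 16, 21, 22, 26, 27} : Finset (Fin 32)) → wit t = 0 := by
  decide +kernel

theorem wit_values : wit 0 = 12 ∧ wit 5 = 11 ∧ wit 6 = 11 ∧ wit 10 = -11 ∧ wit 11 = -11 ∧
    wit 16 = -12 ∧ wit 21 = -11 ∧ wit 22 = -11 ∧ wit 26 = 11 ∧ wit 27 = 11 := by
  decide +kernel

/-- Both `wit` and the cosine change sign under a shift by 16, so the sum is twice 12 + 22
cos(5π/16) + 22 cos(6π/16). -/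
theorem lt_sum_wit_mul_cos :
    65.25 < ∑ t : Fin 32, (wit t : ℝ) * Real.cos (2 * Real.pi * t.val / 32) := by
  have h : ∑ t : Fin 32, (wit t : ℝ) * Real.cos (2 * Real.pi * t.val / 32) =
      24 + 44 * Real.cos (5 * Real.pi / 16) + 44 * Real.cos (3 * Real.pi / 8) := by
    rw [← Finset.sum_subset (Finset.subset_univ
      ({0, 5, 6, 10, 11, 16, 21, 22, 26, 27} : Finset (Fin 32)))
      fun t _ ht => by rw [wit_eq_zero t ht]; simp]
    obtain ⟨w0, w5, w6, w10, w11, w16, w21, w22, w26, w27⟩ := wit_values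
    iterate 9 rw [Finset.sum_insert (by decide)]
    rw [Finset.sum_singleton, w0, w5, w6, w10, w11, w16, w21, w22, w26, w27]
    have c0 : Real.cos (2 * Real.pi * ((0 : Fin 32).val : ℝ) / 32) = 1 := by simp
    have c5 : Real.cos (2 * Real.pi * ((5 : Fin 32).val : ℝ) / 32) =
        Real.cos (5 * Real.pi / 16) := by
      rw [show (5 : Fin 32).val = 5 from rfl]
      congr 1; push_cast; ring
    have c6 : Real.cos (2 * Real.pi * ((6 : Fin 32).val : ℝ) / 32) =
        Real.cos (3 * Real.pi / 8) := by
      rw [show (6 : Fin 32).val = 6 from rfl]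
      congr 1; push_cast; ring
    have c10 : Real.cos (2 * Real.pi * ((10 : Fin 32).val : ℝ) / 32) =
        -Real.cos (3 * Real.pi / 8) := by
      rw [show (10 : Fin 32).val = 10 from rfl, ← Real.cos_pi_sub]
      congr 1; push_cast; ring
    have c11 : Real.cos (2 * Real.pi * ((11 : Fin 32).val : ℝ) / 32) =
        -Real.cos (5 * Real.pi / 16) := by
      rw [show (11 : Fin 32).val = 11 from rfl, ← Real.cos_pi_sub]
      congr 1; push_cast; ring
    have c16 : Real.cos (2 * Real.pi * ((16 : Fin 32).val : ℝ) / 32) = -1 := by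
      rw [show (16 : Fin 32).val = 16 from rfl, ← Real.cos_pi]
      congr 1; push_cast; ring
    have c21 : Real.cos (2 * Real.pi * ((21 : Fin 32).val : ℝ) / 32) =
        -Real.cos (5 * Real.pi / 16) := by
      rw [show (21 : Fin 32).val = 21 from rfl, ← Real.cos_add_pi]
      congr 1; push_cast; ring
    have c22 : Real.cos (2 * Real.pi * ((22 : Fin 32).val : ℝ) / 32) =
        -Real.cos (3 * Real.pi / 8) := by
      rw [show (22 : Fin 32).val = 22 from rfl, ← Real.cos_add_pi]
      congr 1; push_cast; ring
    have c26 : Real.cos (2 * Real.pi * ((26 : Fin 32).val : ℝ) / 32) =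
        Real.cos (3 * Real.pi / 8) := by
      rw [show (26 : Fin 32).val = 26 from rfl, ← Real.cos_two_pi_sub]
      congr 1; push_cast; ring
    have c27 : Real.cos (2 * Real.pi * ((27 : Fin 32).val : ℝ) / 32) =
        Real.cos (5 * Real.pi / 16) := by
      rw [show (27 : Fin 32).val = 27 from rfl, ← Real.cos_two_pi_sub]
      congr 1; push_cast; ring
    rw [c0, c5, c6, c10, c11, c16, c21, c22, c26, c27]
    push_cast
    ring
  rw [h]
  have h1 := cos_three_pi_div_eight_bounds.1
  have h2 := lt_cos_five_pi_div_sixteen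
  norm_num at h1 h2 ⊢
  linarith

theorem gridBehavior_sub (x : Fin 32) (y : Fin 16) :
    gridBehavior x y 0 - gridBehavior x y 1 =
      Real.cos (2 * Real.pi * (x - y.castAdd 16 : Fin 32).val / 32) := by
  rw [gridBehavior, gridBehavior, bornProb_equator_sub]
  have h : (x - y.castAdd 16 : Fin 32).val + y.val = x.val ∨
      (x - y.castAdd 16 : Fin 32).val + y.val = x.val + 32 := by
    rw [Fin.sub_def]
    simp only [Fin.val_castAdd]
    omega
  rcases h with h | h
  · have h' : ((x - y.castAdd 16 : Fin 32).val : ℝ) = x.val - y.val := by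
      rw [eq_sub_iff_add_eq]
      exact_mod_cast h
    rw [h']
    congr 1
    ring
  · have h' : ((x - y.castAdd 16 : Fin 32).val : ℝ) = x.val + 32 - y.val := by
      rw [eq_sub_iff_add_eq]
      exact_mod_cast h
    rw [h', ← Real.cos_add_two_pi]
    congr 1
    ring

/-- The correlations depend on `x - y` only, so all 16 measurements contribute equally, and 16 ·
65.25 = 1044. -/
theorem lt_sum_gridBehavior :
    1044 < ∑ y : Fin 16, ∑ x : Fin 32,
      (wit (x - y.castAdd 16) : ℝ) * (gridBehavior x y 0 - gridBehavior x y 1) := by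
  have h : ∀ y : Fin 16, ∑ x : Fin 32,
      (wit (x - y.castAdd 16) : ℝ) * (gridBehavior x y 0 - gridBehavior x y 1) =
        ∑ t : Fin 32, (wit t : ℝ) * Real.cos (2 * Real.pi * t.val / 32) := fun y => by
    rw [← Equiv.sum_comp (Equiv.subRight (y.castAdd 16 : Fin 32))
      fun t : Fin 32 => (wit t : ℝ) * Real.cos (2 * Real.pi * t.val / 32)]
    refine Finset.sum_congr rfl fun x _ => ?_
    rw [gridBehavior_sub]
    rfl
  rw [Finset.sum_congr rfl fun y _ => h y, Finset.sum_const, Finset.card_univ, Fintype.card_fin,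
    nsmul_eq_mul]
  have := lt_sum_wit_mul_cos
  norm_num at this ⊢
  linarith

/-- For fixed `y`, the inputs are grouped by message; no response to message `k` does better than
the sign of `corr c k y`. -/
theorem strategy_le {c : Fin 32 → Fin 3} (hc : gridSectionNumber c ≤ 6)
    {E : Fin 3 → Fin 16 → ℝ} (hE : ∀ k y, |E k y| ≤ 1) :
    ∑ y : Fin 16, ∑ x : Fin 32, (wit (x - y.castAdd 16) : ℝ) * E (c x) y ≤ 1044 := by
  have h1 : ∑ y : Fin 16, ∑ k, (|corr c k (y.castAdd 16)| : ℝ) ≤ 1044 := by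
    have := (sum_abs_corr c).trans_le (Int.ofNat_le.2 (cyclicTotal_le hc))
    exact_mod_cast this
  refine le_trans (Finset.sum_le_sum fun y _ => ?_) h1
  calc ∑ x : Fin 32, (wit (x - y.castAdd 16) : ℝ) * E (c x) y
      = ∑ k, (corr c k (y.castAdd 16) : ℝ) * E k y := by
        simp only [corr, Int.cast_sum, Finset.sum_mul]
        rw [Finset.sum_comm]
        refine Finset.sum_congr rfl fun x _ => ?_
        rw [Finset.sum_eq_single (c x) (fun k _ hk => by rw [if_neg hk.symm]; simp) (by simp),
          if_pos rfl]
    _ ≤ ∑ k, (|corr c k (y.castAdd 16)| : ℝ) := Finset.sum_le_sum fun k _ => by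
        refine (le_abs_self _).trans ?_
        rw [abs_mul]
        exact mul_le_of_le_one_right (abs_nonneg _) (hE k y)

end SectionSearch

open SectionSearch in
theorem frequently_seven_le_gridSectionNumber {Λ : Type u} [MeasurableSpace Λ]
    (P : ClassicalModel gridBehavior 3 Λ) (D : Fin 32 → Λ → Fin 3)
    (hD : P.IsDeterministicEncoding D) :
    ∃ᶠ l in ae P.prob, 7 ≤ gridSectionNumber fun x => D x l := by
  intro hev
  refine absurd lt_sum_gridBehavior (not_lt.2 (P.sum_correlations_le _ _ ?_))
  filter_upwards [hev] with l hl
  have henc : ∀ x y, ∑ c, P.enc x l c * P.expect c y l = P.expect (D x l) y l := fun x y => by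
    rw [Finset.sum_eq_single (D x l)
      (fun c _ hc => by rw [hD, if_neg hc.symm, zero_mul]) (by simp), hD, if_pos rfl, one_mul]
  simp only [henc]
  exact strategy_le (c := fun x => D x l) (E := fun k y => P.expect k y l) (by omega)
    fun k y => P.abs_expect_le k y l

/-! ### Fewer inputs -/

section

variable {X Y X' Y' : Type} {B : Y → Type} [∀ y, Fintype (B y)] {p : X → (y : Y) → B y → ℝ}
  {d : ℕ} {Λ : Type u} [MeasurableSpace Λ]

/-- The restriction of a classical model to some of the inputs. -/
def ClassicalModel.comap (P : ClassicalModel p d Λ) (f : X' → X) (g : Y' → Y) :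
    ClassicalModel (fun x y b => p (f x) (g y) b) d Λ where
  prob := P.prob
  isProbabilityMeasure := P.isProbabilityMeasure
  enc x := P.enc (f x)
  enc_measurable x := P.enc_measurable (f x)
  enc_nonneg x := P.enc_nonneg (f x)
  enc_sum x := P.enc_sum (f x)
  dec c y := P.dec c (g y)
  dec_measurable c y := P.dec_measurable c (g y)
  dec_nonneg c y := P.dec_nonneg c (g y)
  dec_sum c y := P.dec_sum c (g y)
  simulates x y := P.simulates (f x) (g y)

end

/-- The restriction of a classical model of the real qubit to pure states and projective
measurements. -/
noncomputable def ClassicalModel.onEquator {X Y : Type} {d : ℕ} {Λ : Type u} [MeasurableSpace Λ]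
    (P : ClassicalModel rebitBehavior d Λ) (θ : X → ℝ) (φ : Y → ℝ) :
    ClassicalModel (B := fun _ : Y => Fin 2) (fun (x : X) (y : Y) (b : Fin 2) =>
      bornProb (equatorState (θ x)) (equatorMeasurement (φ y)) b) d Λ :=
  P.comap (fun x => equatorState (θ x)) fun y => ⟨2, equatorMeasurement (φ y)⟩

theorem gridSectionNumber_le_sectionNumber {d : ℕ} (c : RebitState → Fin d) :
    (gridSectionNumber (fun x : Fin 32 =>
      c (equatorState (2 * Real.pi * ((x.val : ℝ) + 1) / 32))) : ℕ∞) ≤ sectionNumber c := by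
  have hpi := Real.pi_pos
  have periodic : equatorState (2 * Real.pi) = equatorState 0 := by
    simp [equatorState]
  -- The cap at 32 keeps the whole sequence in the interval; only the first 32 steps are used.
  set θ : ℕ → ℝ := fun i => 2 * Real.pi * (min i 32 : ℕ) / 32 with hθ
  have hθ' : ∀ i ≤ 32, θ i = 2 * Real.pi * i / 32 := fun i hi => by
    rw [hθ]
    simp only [min_eq_left hi]
  have hmono : Monotone θ ∧ ∀ i, θ i ∈ Set.Icc 0 (2 * Real.pi) := by
    refine ⟨fun i j hij => ?_, fun i => ⟨by positivity, ?_⟩⟩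
    · have : ((min i 32 : ℕ) : ℝ) ≤ (min j 32 : ℕ) := by
        exact_mod_cast min_le_min_right 32 hij
      simp only [hθ]
      gcongr
    · have : ((min i 32 : ℕ) : ℝ) ≤ 32 := by exact_mod_cast min_le_right i 32
      simp only [hθ]
      rw [div_le_iff₀ (by norm_num)]
      gcongr
  refine le_trans ?_ (le_iSup_of_le 32 (le_iSup_of_le θ (le_iSup_of_le hmono le_rfl)))
  rw [Nat.cast_le, gridSectionNumber]
  -- Input `x` sits at angle index `x + 1`, so its change is step `x + 1` modulo 32. For `x = 31`
  -- this is step 0, since the angles 0 and 2π give the same state.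
  refine Finset.card_le_card_of_injOn (fun x => (x + 1).val) ?_ ?_
  · intro x hx
    simp only [Finset.coe_filter, Finset.mem_univ, true_and, Set.mem_ofPred_eq] at hx
    simp only [Finset.coe_filter, Finset.mem_range, Set.mem_ofPred_eq]
    refine ⟨(x + 1).isLt, ?_⟩
    rw [hθ' _ (x + 1).isLt.le, hθ' _ (x + 1).isLt]
    have h1 : equatorState (2 * Real.pi * ((x + 1).val : ℝ) / 32) =
        equatorState (2 * Real.pi * ((x.val : ℝ) + 1) / 32) := by
      rcases Nat.lt_or_ge (x.val + 1) 32 with h | h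
      · rw [Fin.val_add_one_of_lt' h]
        push_cast
        rfl
      · have hx31 : x = 31 := Fin.ext (by have := x.isLt; change x.val = 31; omega)
        subst hx31
        rw [show ((31 : Fin 32) + 1).val = 0 from rfl, show (31 : Fin 32).val = 31 from rfl]
        convert periodic.symm using 2
        · simp
        · push_cast
          ring
    rw [h1]
    push_cast
    exact hx
  · intro x _ y _ h
    exact add_right_cancel (Fin.ext h)

/-! ### Two messages do not suffice -/

/-- With u = e - g and v = f - h the bound is |u + v| + |u - v| = 2 max(|u|, |v|) ≤ 4. -/
theorem two_message_bound {a b e f g h : ℝ} (ha : |a| ≤ 1) (hb : |b| ≤ 1) (he : |e| ≤ 1)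
    (hf : |f| ≤ 1) (hg : |g| ≤ 1) (hh : |h| ≤ 1) :
    a * (e + f - g - h) + b * (e - f - g + h) ≤ 4 := by
  have h1 : a * (e + f - g - h) ≤ |e + f - g - h| := by
    refine (le_abs_self _).trans ?_
    rw [abs_mul]
    exact mul_le_of_le_one_left (abs_nonneg _) ha
  have h2 : b * (e - f - g + h) ≤ |e - f - g + h| := by
    refine (le_abs_self _).trans ?_
    rw [abs_mul]
    exact mul_le_of_le_one_left (abs_nonneg _) hb
  rw [abs_le] at he hf hg hh
  rcases abs_cases (e + f - g - h) with h3 | h3 <;>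
    rcases abs_cases (e - f - g + h) with h4 | h4 <;> linarith

theorem three_le_of_classicalModel {d : ℕ} {Λ : Type u} [MeasurableSpace Λ]
    (P : ClassicalModel rebitBehavior d Λ) : 3 ≤ d := by
  by_contra! hd
  -- Four states on the diagonals and two measurements along the axes: each of the eight
  -- correlations has modulus √2/2, and `w` contains their signs, so the quantum value is 4√2.
  set θ : Fin 4 → ℝ := ![Real.pi / 4, Real.pi - Real.pi / 4, Real.pi / 4 + Real.pi,
    2 * Real.pi - Real.pi / 4] with hθ
  set φ : Fin 2 → ℝ := ![0, Real.pi / 2] with hφ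
  set w : Fin 4 → Fin 2 → ℝ := ![![1, 1], ![-1, 1], ![-1, -1], ![1, -1]] with hw
  set Q := P.onEquator θ φ with hQ
  have key := Q.sum_correlations_le w 4 (Eventually.of_forall fun l => ?_)
  · simp only [bornProb_equator_sub] at key
    simp only [Fin.sum_univ_two, Fin.sum_univ_four, hw, hθ, hφ, Matrix.cons_val_zero,
      Matrix.cons_val_one, Matrix.cons_val, sub_zero, Real.cos_sub_pi_div_two, Real.cos_pi_sub,
      Real.sin_pi_sub, Real.cos_add_pi, Real.sin_add_pi, Real.cos_two_pi_sub,
      Real.sin_two_pi_sub, Real.cos_pi_div_four, Real.sin_pi_div_four] at key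
    have h2 : (1.4 : ℝ) < √2 := Real.lt_sqrt_of_sq_lt (by norm_num)
    norm_num at key h2
    linarith
  · simp only [Fin.sum_univ_two, Fin.sum_univ_four, hw, Matrix.cons_val_zero,
      Matrix.cons_val_one, Matrix.cons_val]
    have hs := fun x => Q.enc_sum x l
    have hn := fun x => Q.enc_nonneg x l
    have he := fun c y => Q.abs_expect_le c y l
    -- The weights of each measurement sum to zero. Hence one message contributes nothing, and two
    -- messages enter only through differences of the probabilities of message 0 between antipodal
    -- states.
    interval_cases d
    · simp
    · simp only [Fin.sum_univ_one] at hs ⊢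
      simp only [hs]
      linarith
    · simp only [Fin.sum_univ_two] at hs ⊢
      have hb : ∀ x x', |Q.enc x l 0 - Q.enc x' l 0| ≤ 1 := fun x x' => by
        rw [abs_le]
        constructor <;> linarith [hs x, hs x', hn x 0, hn x' 0, hn x 1, hn x' 1]
      have := two_message_bound (hb 0 2) (hb 3 1) (he 0 0) (he 0 1) (he 1 0) (he 1 1)
      have e1 : ∀ x, Q.enc x l 1 = 1 - Q.enc x l 0 := fun x => by linarith [hs x]
      simp only [e1]
      linarith

/-! ### From the grid to the full real qubit -/

theorem frequently_seven_le_sectionNumber {Λ : Type u} [MeasurableSpace Λ]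
    (P : ClassicalModel rebitBehavior 3 Λ) (D : RebitState → Λ → Fin 3)
    (hD : P.IsDeterministicEncoding D) :
    ∃ᶠ l in ae P.prob, 7 ≤ sectionNumber fun ρ => D ρ l := by
  have h := frequently_seven_le_gridSectionNumber
    (P.onEquator (fun x : Fin 32 => 2 * Real.pi * ((x.val : ℝ) + 1) / 32)
      fun y : Fin 16 => Real.pi * ((y.val : ℝ) + 1) / 16)
    (fun x => D (equatorState (2 * Real.pi * ((x.val : ℝ) + 1) / 32))) fun x => hD _
  refine Frequently.mono h fun l hl => ?_
  refine le_trans ?_ (gridSectionNumber_le_sectionNumber fun ρ => D ρ l)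
  exact_mod_cast hl

/-! ### Choosing between two random directions -/

namespace FourMessages

/-- The probability weight with which the direction at angle `b` to a line is not chosen, if the
other direction is closer to this line. -/
noncomputable def bias (b : ℝ) : ℝ := Real.pi ^ 2 / 4 * ((Real.sin b - b * Real.cos b) / b ^ 2)

theorem hasDerivAt_sin_sub_mul_cos (b : ℝ) :
    HasDerivAt (fun b => Real.sin b - b * Real.cos b) (b * Real.sin b) b := by
  have := (Real.hasDerivAt_sin b).sub ((hasDerivAt_id b).mul (Real.hasDerivAt_cos b))
  exact this.congr_deriv (by simp)

theorem sin_sub_mul_cos_nonneg {b : ℝ} (h0 : 0 ≤ b) (h1 : b ≤ Real.pi / 2) :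
    0 ≤ Real.sin b - b * Real.cos b := by
  have hmono : MonotoneOn (fun b => Real.sin b - b * Real.cos b) (Set.Icc 0 b) := by
    refine monotoneOn_of_deriv_nonneg (convex_Icc 0 b)
      (fun x _ => (hasDerivAt_sin_sub_mul_cos x).continuousAt.continuousWithinAt)
      (fun x _ => (hasDerivAt_sin_sub_mul_cos x).differentiableAt.differentiableWithinAt)
      fun x hx => ?_
    rw [interior_Icc] at hx
    rw [(hasDerivAt_sin_sub_mul_cos x).deriv]
    exact mul_nonneg hx.1.le (Real.sin_nonneg_of_nonneg_of_le_pi hx.1.le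
      (by linarith [hx.2, Real.pi_pos]))
  simpa using hmono (Set.left_mem_Icc.2 h0) (Set.right_mem_Icc.2 h0) h0

/-- The difference `h` of the two sides vanishes at 0 and at π/2. The sign of its derivative is that
of 2 - (π²/4) sin x, so `h` first increases and then decreases, and is nonnegative in between. -/
theorem sin_sub_mul_cos_le {b : ℝ} (h0 : 0 ≤ b) (h1 : b ≤ Real.pi / 2) :
    Real.pi ^ 2 / 4 * (Real.sin b - b * Real.cos b) ≤ b ^ 2 := by
  set h : ℝ → ℝ := fun b => b ^ 2 - Real.pi ^ 2 / 4 * (Real.sin b - b * Real.cos b) with hh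
  have hpi := Real.pi_pos
  have hd : ∀ x, HasDerivAt h (x * (2 - Real.pi ^ 2 / 4 * Real.sin x)) x := fun x => by
    have := (hasDerivAt_pow 2 x).sub ((hasDerivAt_sin_sub_mul_cos x).const_mul (Real.pi ^ 2 / 4))
    exact this.congr_deriv (by push_cast; ring)
  suffices 0 ≤ h b by
    simp only [hh] at this
    linarith
  have hsin : ∀ {x y : ℝ}, 0 ≤ x → x ≤ y → y ≤ Real.pi / 2 → Real.sin x ≤ Real.sin y :=
    fun hx hxy hy => Real.sin_le_sin_of_le_of_le_pi_div_two (by linarith) hy hxy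
  rcases le_total (Real.pi ^ 2 / 4 * Real.sin b) 2 with hb | hb
  · have hmono : MonotoneOn h (Set.Icc 0 b) := by
      refine monotoneOn_of_deriv_nonneg (convex_Icc 0 b)
        (fun x _ => (hd x).continuousAt.continuousWithinAt)
        (fun x _ => (hd x).differentiableAt.differentiableWithinAt) fun x hx => ?_
      rw [interior_Icc] at hx
      rw [(hd x).deriv]
      refine mul_nonneg hx.1.le ?_
      have := mul_le_mul_of_nonneg_left (hsin hx.1.le hx.2.le h1)
        (by positivity : 0 ≤ Real.pi ^ 2 / 4)
      linarith
    simpa [hh] using hmono (Set.left_mem_Icc.2 h0) (Set.right_mem_Icc.2 h0) h0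
  · have hanti : AntitoneOn h (Set.Icc b (Real.pi / 2)) := by
      refine antitoneOn_of_deriv_nonpos (convex_Icc b (Real.pi / 2))
        (fun x _ => (hd x).continuousAt.continuousWithinAt)
        (fun x _ => (hd x).differentiableAt.differentiableWithinAt) fun x hx => ?_
      rw [interior_Icc] at hx
      rw [(hd x).deriv]
      refine mul_nonpos_of_nonneg_of_nonpos (h0.trans hx.1.le) ?_
      have := mul_le_mul_of_nonneg_left (hsin h0 hx.1.le hx.2.le)
        (by positivity : 0 ≤ Real.pi ^ 2 / 4)
      linarith
    have := hanti (Set.left_mem_Icc.2 h1) (Set.right_mem_Icc.2 h1) h1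
    simp only [hh, Real.sin_pi_div_two, Real.cos_pi_div_two] at this ⊢
    linarith

theorem bias_nonneg {b : ℝ} (h0 : 0 ≤ b) (h1 : b ≤ Real.pi / 2) : 0 ≤ bias b :=
  mul_nonneg (by positivity) (div_nonneg (sin_sub_mul_cos_nonneg h0 h1) (by positivity))

theorem bias_le_one {b : ℝ} (h0 : 0 ≤ b) (h1 : b ≤ Real.pi / 2) : bias b ≤ 1 := by
  rw [bias, ← mul_div_assoc]
  exact div_le_one_of_le₀ (sin_sub_mul_cos_le h0 h1) (by positivity)

theorem measurable_bias : Measurable bias := by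
  unfold bias
  fun_prop

/-- An antisymmetric function of two angles in `[0, π/2]`. -/
noncomputable def kernel (a b : ℝ) : ℝ := if a < b then bias b else if b < a then -bias a else 0

theorem kernel_antisymm (a b : ℝ) : kernel b a = -kernel a b := by
  rcases lt_trichotomy a b with h | h | h
  · simp [kernel, h, h.not_gt]
  · simp [kernel, h]
  · simp [kernel, h, h.not_gt]

theorem abs_kernel_le {a b : ℝ} (ha : a ∈ Set.Icc 0 (Real.pi / 2))
    (hb : b ∈ Set.Icc 0 (Real.pi / 2)) : |kernel a b| ≤ 1 := by
  unfold kernel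
  split_ifs
  · rw [abs_of_nonneg (bias_nonneg hb.1 hb.2)]
    exact bias_le_one hb.1 hb.2
  · rw [abs_neg, abs_of_nonneg (bias_nonneg ha.1 ha.2)]
    exact bias_le_one ha.1 ha.2
  · simp

theorem measurable_kernel : Measurable fun z : ℝ × ℝ => kernel z.1 z.2 :=
  Measurable.ite (measurableSet_lt measurable_fst measurable_snd)
    (measurable_bias.comp measurable_snd)
    (Measurable.ite (measurableSet_lt measurable_snd measurable_fst)
      (measurable_bias.comp measurable_fst).neg measurable_const)

/-- Shows that `bias` is -π²/4 times the derivative of `sinc`, so that its integral is explicit. -/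
theorem hasDerivAt_sinc {b : ℝ} (hb : b ≠ 0) :
    HasDerivAt Real.sinc (-((Real.sin b - b * Real.cos b) / b ^ 2)) b := by
  have h := (Real.hasDerivAt_sin b).div (hasDerivAt_id b) hb
  refine (h.congr_of_eventuallyEq ?_).congr_deriv ?_
  · filter_upwards [isOpen_ne.mem_nhds hb] with x hx
    rw [Real.sinc_of_ne_zero hx]
    rfl
  · simp only [id]
    ring

theorem intervalIntegrable_of_bound {f : ℝ → ℝ} (hf : Measurable f) {a b C : ℝ}
    (h : ∀ x ∈ Set.uIoc a b, |f x| ≤ C) : IntervalIntegrable f volume a b := by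
  refine (intervalIntegrable_const (c := C)).mono_fun hf.aestronglyMeasurable ?_
  refine (ae_restrict_iff' measurableSet_uIoc).2 (Eventually.of_forall fun x hx => ?_)
  exact (h x hx).trans (le_abs_self C)

theorem integral_bias {a : ℝ} (h0 : 0 ≤ a) (h1 : a ≤ Real.pi / 2) :
    ∫ b in a..(Real.pi / 2), bias b = Real.pi ^ 2 / 4 * Real.sinc a - Real.pi / 2 := by
  have hpi := Real.pi_pos
  rw [intervalIntegral.integral_eq_sub_of_hasDerivAt_of_le
    (f := fun b => -(Real.pi ^ 2 / 4) * Real.sinc b) h1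
    (Continuous.continuousOn (continuous_const.mul Real.continuous_sinc))
    (fun b hb => ((hasDerivAt_sinc (h0.trans_lt hb.1).ne').const_mul _).congr_deriv
      (by rw [bias]; ring)) ?_]
  · rw [Real.sinc_of_ne_zero (by positivity), Real.sin_pi_div_two]
    field_simp
    ring
  · refine intervalIntegrable_of_bound measurable_bias (C := 1) fun b hb => ?_
    rw [Set.uIoc_of_le h1] at hb
    have hb0 : 0 ≤ b := h0.trans hb.1.le
    rw [abs_of_nonneg (bias_nonneg hb0 hb.2)]
    exact bias_le_one hb0 hb.2

/-- This identity determines `bias`. The integral is -a bias(a) plus the integral of `bias` from a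
to π/2; equating derivatives gives (a² bias(a))' = (π²/4) a sin a, whence a² bias(a) = (π²/4)(sin a
- a cos a). The constant -π/2 comes from sinc(π/2) = 2/π. -/
theorem integral_kernel {a : ℝ} (h0 : 0 ≤ a) (h1 : a ≤ Real.pi / 2) :
    ∫ b in (0 : ℝ)..(Real.pi / 2), kernel a b =
      Real.pi ^ 2 / 4 * Real.cos a - Real.pi / 2 := by
  have hm : Measurable (kernel a) := measurable_kernel.comp (measurable_const.prodMk measurable_id)
  have hint : ∀ x y, 0 ≤ x → x ≤ y → y ≤ Real.pi / 2 →
      IntervalIntegrable (kernel a) volume x y := fun x y hx hxy hy => by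
    refine intervalIntegrable_of_bound hm (C := 1) fun b hb => ?_
    rw [Set.uIoc_of_le hxy] at hb
    exact abs_kernel_le ⟨h0, h1⟩ ⟨hx.trans hb.1.le, hb.2.trans hy⟩
  rw [← intervalIntegral.integral_add_adjacent_intervals (hint 0 a le_rfl h0 h1)
    (hint a _ h0 h1 le_rfl)]
  have e1 : ∫ b in (0 : ℝ)..a, kernel a b = ∫ _ in (0 : ℝ)..a, -bias a := by
    refine intervalIntegral.integral_congr_ae ?_
    filter_upwards [compl_mem_ae_iff.2 (measure_singleton a)] with b hb hb'
    rw [Set.uIoc_of_le h0] at hb'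
    have hlt : b < a := lt_of_le_of_ne hb'.2 hb
    simp [kernel, hlt, hlt.not_gt]
  have e2 : ∫ b in a..(Real.pi / 2), kernel a b = ∫ b in a..(Real.pi / 2), bias b := by
    refine intervalIntegral.integral_congr_ae (Eventually.of_forall fun b hb => ?_)
    rw [Set.uIoc_of_le h1] at hb
    simp [kernel, hb.1]
  rw [e1, e2, intervalIntegral.integral_const, integral_bias h0 h1, smul_eq_mul, bias]
  rcases h0.eq_or_lt with rfl | h
  · simp
  · rw [Real.sinc_of_ne_zero h.ne']
    field_simp
    ring

/-! ### Averages over the circle -/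

/-- The uniform distribution of an angle. -/
noncomputable def angle : Measure ℝ :=
  ENNReal.ofReal (2 * Real.pi)⁻¹ • volume.restrict (Set.Ioc 0 (2 * Real.pi))

instance : IsProbabilityMeasure angle := by
  constructor
  have hpi := Real.pi_pos
  rw [angle, Measure.smul_apply, Measure.restrict_apply_univ, Real.volume_Ioc, smul_eq_mul,
    ← ENNReal.ofReal_mul (by positivity), sub_zero, inv_mul_cancel₀ (by positivity),
    ENNReal.ofReal_one]

theorem integral_angle (f : ℝ → ℝ) :
    ∫ α, f α ∂angle = (2 * Real.pi)⁻¹ * ∫ α in (0 : ℝ)..(2 * Real.pi), f α := by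
  have hpi := Real.pi_pos
  rw [angle, integral_smul_measure, ENNReal.toReal_ofReal (by positivity), smul_eq_mul,
    intervalIntegral.integral_of_le (by positivity)]

theorem integral_angle_sub {f : ℝ → ℝ} (hf : Function.Periodic f (2 * Real.pi)) (φ : ℝ) :
    ∫ α, f (α - φ) ∂angle = ∫ α, f α ∂angle := by
  rw [integral_angle, integral_angle, intervalIntegral.integral_comp_sub_right,
    show 2 * Real.pi - φ = (0 - φ) + 2 * Real.pi by ring, hf.intervalIntegral_add_eq _ 0, zero_add]

theorem integral_angle_abs_cos {g : ℝ → ℝ} (hg : Measurable g) {C : ℝ}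
    (hC : ∀ u, |g (|Real.cos u|)| ≤ C) :
    ∫ α, g (|Real.cos α|) ∂angle =
      2 / Real.pi * ∫ α in (0 : ℝ)..(Real.pi / 2), g (Real.cos α) := by
  have hpi := Real.pi_pos
  set f : ℝ → ℝ := fun α => g (|Real.cos α|) with hf
  have hfm : Measurable f := hg.comp (Real.continuous_cos.abs.measurable)
  have hint : ∀ a b, IntervalIntegrable f volume a b := fun a b =>
    intervalIntegrable_of_bound hfm fun x _ => hC x
  have hper : Function.Periodic f Real.pi := fun x => by
    simp only [hf, Real.cos_add_pi, abs_neg]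
  have h1 : ∫ α in (0 : ℝ)..(2 * Real.pi), f α = 2 * ∫ α in (0 : ℝ)..Real.pi, f α := by
    rw [← intervalIntegral.integral_add_adjacent_intervals (hint 0 Real.pi) (hint _ _)]
    have := hper.intervalIntegral_add_eq Real.pi 0
    rw [zero_add, ← two_mul] at this
    rw [this]
    ring
  have h2 : ∫ α in (0 : ℝ)..Real.pi, f α = 2 * ∫ α in (0 : ℝ)..(Real.pi / 2), f α := by
    rw [← intervalIntegral.integral_add_adjacent_intervals (hint 0 (Real.pi / 2)) (hint _ _)]
    have := intervalIntegral.integral_comp_sub_left f (a := 0) (b := Real.pi / 2) Real.pi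
    rw [sub_zero, sub_half] at this
    rw [← this, two_mul]
    congr 1
    refine intervalIntegral.integral_congr fun x _ => ?_
    simp only [hf, Real.cos_pi_sub, abs_neg]
  have h3 : ∫ α in (0 : ℝ)..(Real.pi / 2), f α =
      ∫ α in (0 : ℝ)..(Real.pi / 2), g (Real.cos α) := by
    refine intervalIntegral.integral_congr fun x hx => ?_
    rw [Set.uIcc_of_le (by positivity)] at hx
    simp only [hf]
    rw [abs_of_nonneg (Real.cos_nonneg_of_mem_Icc ⟨by linarith [hx.1], hx.2⟩)]
  rw [integral_angle, h1, h2, h3]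
  field_simp

theorem integral_abs_cos_sub (φ : ℝ) : ∫ α, |Real.cos (α - φ)| ∂angle = 2 / Real.pi := by
  rw [integral_angle_sub (f := fun α => |Real.cos α|) (fun x => by simp)]
  refine (integral_angle_abs_cos (g := id) measurable_id (C := 1)
    (fun u => by simpa using Real.abs_cos_le_one u)).trans ?_
  simp

/-- The sign of the scalar product of two unit vectors. -/
noncomputable def side (θ α : ℝ) : ℝ := if 0 ≤ Real.cos (α - θ) then 1 else -1

theorem side_eq (θ α : ℝ) : side θ α = 1 ∨ side θ α = -1 := by
  unfold side
  split_ifs <;> simp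

theorem abs_side (θ α : ℝ) : |side θ α| = 1 := by
  rcases side_eq θ α with h | h <;> simp [h]

theorem measurable_side (θ : ℝ) : Measurable (side θ) :=
  Measurable.ite (measurableSet_le measurable_const (by fun_prop)) measurable_const measurable_const

theorem integrable_angle {f : ℝ → ℝ} (hf : Measurable f) {C : ℝ} (hC : ∀ x, |f x| ≤ C) :
    Integrable f angle :=
  Integrable.of_bound hf.aestronglyMeasurable C (Eventually.of_forall hC)

theorem integral_side_mul_sin : ∫ α, side 0 α * Real.sin α ∂angle = 0 := by
  have hper : Function.Periodic (fun α => side 0 α * Real.sin α) (2 * Real.pi) := fun x => by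
    simp [side]
  have h := intervalIntegral.integral_comp_neg (fun α => side 0 α * Real.sin α)
    (a := -Real.pi) (b := Real.pi)
  rw [neg_neg] at h
  have h' : ∀ α, side 0 (-α) * Real.sin (-α) = -(side 0 α * Real.sin α) := fun α => by
    simp [side]
  simp only [h', intervalIntegral.integral_neg] at h
  have h2 := hper.intervalIntegral_add_eq 0 (-Real.pi)
  rw [zero_add, show -Real.pi + 2 * Real.pi = Real.pi by ring] at h2
  rw [integral_angle, h2]
  rw [show ∫ x in -Real.pi..Real.pi, side 0 x * Real.sin x = 0 by linarith, mul_zero]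

/-- Split the cosine into parts along and across the direction θ. Along θ, the sign turns the cosine
into its absolute value, of mean 2/π; across θ, the integrand is odd and averages to zero. -/
theorem integral_side_mul_cos (θ φ : ℝ) :
    ∫ α, side θ α * Real.cos (α - φ) ∂angle = 2 / Real.pi * Real.cos (θ - φ) := by
  have hper : Function.Periodic (fun α => side 0 α * Real.cos (α - (φ - θ))) (2 * Real.pi) :=
    fun x => by
      dsimp only
      rw [show x + 2 * Real.pi - (φ - θ) = x - (φ - θ) + 2 * Real.pi by ring]
      simp [side]
  have h1 := integral_angle_sub hper θ
  have e1 : ∀ α, side 0 (α - θ) * Real.cos (α - θ - (φ - θ)) =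
      side θ α * Real.cos (α - φ) := fun α => by
    simp [side]
  have e2 : ∀ α, side 0 α * Real.cos (α - (φ - θ)) =
      Real.cos (θ - φ) * |Real.cos (α - 0)| + Real.sin (φ - θ) * (side 0 α * Real.sin α) := by
    intro α
    have : side 0 α * Real.cos α = |Real.cos α| := by
      rw [side, sub_zero]
      split_ifs with h
      · rw [abs_of_nonneg h, one_mul]
      · rw [abs_of_neg (not_le.1 h), neg_one_mul]
    rw [Real.cos_sub α, sub_zero, ← this, ← Real.cos_neg (θ - φ), neg_sub]
    ring
  simp only [e1, e2] at h1
  rw [h1, integral_add, integral_const_mul, integral_const_mul, integral_abs_cos_sub,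
    integral_side_mul_sin]
  · ring
  · refine (integrable_angle (C := 1) (by fun_prop) fun x => ?_).const_mul _
    rw [abs_abs]
    exact Real.abs_cos_le_one _
  · refine (integrable_angle (C := 1) ((measurable_side 0).mul Real.measurable_sin)
      fun x => ?_).const_mul _
    rw [Pi.mul_apply, abs_mul, abs_side, one_mul]
    exact Real.abs_sin_le_one _

/-- The angle in `[0, π/2]` between the direction `α` and the line in direction `0`. -/
noncomputable def lineAngle (α : ℝ) : ℝ := Real.arccos |Real.cos α|

theorem lineAngle_mem (α : ℝ) : lineAngle α ∈ Set.Icc 0 (Real.pi / 2) :=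
  ⟨Real.arccos_nonneg _, Real.arccos_le_pi_div_two.2 (abs_nonneg _)⟩

theorem measurable_lineAngle : Measurable lineAngle :=
  (Real.continuous_arccos.comp Real.continuous_cos.abs).measurable

theorem cos_lineAngle (α : ℝ) : Real.cos (lineAngle α) = |Real.cos α| :=
  Real.cos_arccos (by linarith [abs_nonneg (Real.cos α)]) (Real.abs_cos_le_one α)

theorem integral_kernel_lineAngle (α φ : ℝ) :
    ∫ β, kernel (lineAngle α) (lineAngle (β - φ)) ∂angle = Real.pi / 2 * |Real.cos α| - 1 := by
  have hpi := Real.pi_pos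
  rw [integral_angle_sub (f := fun β => kernel (lineAngle α) (lineAngle β))
    (fun x => by simp [lineAngle])]
  refine (integral_angle_abs_cos (g := fun v => kernel (lineAngle α) (Real.arccos v)) (C := 1)
    ?_ ?_).trans ?_
  · exact measurable_kernel.comp (measurable_const.prodMk Real.continuous_arccos.measurable)
  · exact fun u => abs_kernel_le (lineAngle_mem α) (lineAngle_mem u)
  · have : ∫ β in (0 : ℝ)..(Real.pi / 2), kernel (lineAngle α) (Real.arccos (Real.cos β)) =
        ∫ β in (0 : ℝ)..(Real.pi / 2), kernel (lineAngle α) β := by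
      refine intervalIntegral.integral_congr fun x hx => ?_
      rw [Set.uIcc_of_le (by positivity)] at hx
      rw [Real.arccos_cos hx.1 (by linarith [hx.2])]
    rw [this, integral_kernel (lineAngle_mem α).1 (lineAngle_mem α).2, cos_lineAngle]
    field_simp
    ring

end FourMessages

namespace FourMessages

/-! ### Decoding -/

section Decoding

/-- Scalar product of the direction `α` with the vector of length `μ b` in direction `φ b`. -/
noncomputable def overlap {B : Type} (μ φ : B → ℝ) (b : B) (α : ℝ) : ℝ := μ b * Real.cos (α - φ b)

theorem measurable_overlap {B : Type} (μ φ : B → ℝ) (b : B) : Measurable (overlap μ φ b) := by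
  unfold overlap
  fun_prop

/-- As max(x, 0) = (x + |x|)/2, the mean has the form 1 + cos of Born's rule. The factor 1/π instead
of 1/2 is repaired by the factor π/2 in `integral_choice`. -/
theorem integral_max_side_mul_overlap {B : Type} {μ φ : B → ℝ} (hμ : ∀ b, 0 ≤ μ b) (θ : ℝ)
    (b : B) : ∫ α, max (side θ α * overlap μ φ b α) 0 ∂angle =
      μ b * (1 + Real.cos (θ - φ b)) / Real.pi := by
  have e : ∀ α, max (side θ α * overlap μ φ b α) 0 =
      μ b / 2 * (side θ α * Real.cos (α - φ b)) + μ b / 2 * |Real.cos (α - φ b)| := fun α => by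
    have h : |side θ α * overlap μ φ b α| = μ b * |Real.cos (α - φ b)| := by
      rw [abs_mul, abs_side, one_mul, overlap, abs_mul, abs_of_nonneg (hμ b)]
    rw [max_def']
    split_ifs with h0
    · rw [abs_of_nonneg h0] at h
      rw [mul_comm (μ b / 2) |_|, ← mul_div_assoc, mul_comm |_|, ← h, overlap]
      ring
    · rw [abs_of_neg (not_le.1 h0)] at h
      rw [mul_comm (μ b / 2) |_|, ← mul_div_assoc, mul_comm |_|, ← h, overlap]
      ring
  simp only [e]
  rw [integral_add, integral_const_mul, integral_const_mul, integral_side_mul_cos,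
    integral_abs_cos_sub]
  · ring
  · refine (integrable_angle (C := 1) ((measurable_side θ).mul (by fun_prop)) fun x => ?_).const_mul
      _
    rw [Pi.mul_apply, abs_mul, abs_side, one_mul]
    exact Real.abs_cos_le_one _
  · refine (integrable_angle (C := 1) (by fun_prop) fun x => ?_).const_mul _
    rw [abs_abs]
    exact Real.abs_cos_le_one _

variable {B : Type} [Fintype B] (μ φ : B → ℝ)

/-- For a measurement the overlaps sum to zero, so positive and negative parts balance and the same
`load` normalizes the shares for both signs. -/
noncomputable def load (α : ℝ) : ℝ := ∑ b, max (overlap μ φ b α) 0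

/-- The probability of the outcome `b` if Bob knows that the direction `σ α` is on the side of the
state. -/
noncomputable def share (b : B) (σ α : ℝ) : ℝ :=
  if load μ φ α = 0 then μ b / ∑ b, μ b else max (σ * overlap μ φ b α) 0 / load μ φ α

/-- The weight with which the direction `α`, and not `β`, is used. -/
noncomputable def choice (α β : ℝ) : ℝ :=
  (∑ b, μ b) / 2 + (∑ b, μ b * kernel (lineAngle (α - φ b)) (lineAngle (β - φ b))) / 2

theorem measurable_load : Measurable (load μ φ) :=
  Finset.measurable_sum _ fun b _ => (measurable_overlap μ φ b).max measurable_const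

theorem measurable_share (b : B) {σ : ℝ → ℝ} (hσ : Measurable σ) :
    Measurable fun α => share μ φ b (σ α) α :=
  Measurable.ite (measurable_load μ φ (measurableSet_singleton 0)) measurable_const
    (((hσ.mul (measurable_overlap μ φ b)).max measurable_const).div (measurable_load μ φ))

theorem measurable_choice : Measurable fun z : ℝ × ℝ => choice μ φ z.1 z.2 := by
  refine measurable_const.add (Measurable.div_const (Finset.measurable_sum _ fun b _ => ?_) 2)
  exact (measurable_kernel.comp
    ((measurable_lineAngle.comp (measurable_fst.sub_const _)).prodMk
      (measurable_lineAngle.comp (measurable_snd.sub_const _)))).const_mul _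

theorem choice_add_choice (α β : ℝ) : choice μ φ α β + choice μ φ β α = ∑ b, μ b := by
  have : ∀ b, μ b * kernel (lineAngle (β - φ b)) (lineAngle (α - φ b)) =
      -(μ b * kernel (lineAngle (α - φ b)) (lineAngle (β - φ b))) := fun b => by
    rw [kernel_antisymm, mul_neg]
  rw [choice, choice, Finset.sum_congr rfl fun b _ => this b, Finset.sum_neg_distrib]
  ring

variable {μ φ}

theorem load_nonneg (α : ℝ) : 0 ≤ load μ φ α := Finset.sum_nonneg fun _ _ => le_max_right _ _

theorem choice_nonneg (hμ : ∀ b, 0 ≤ μ b) (α β : ℝ) : 0 ≤ choice μ φ α β := by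
  have h : -∑ b, μ b ≤ ∑ b, μ b * kernel (lineAngle (α - φ b)) (lineAngle (β - φ b)) := by
    rw [← Finset.sum_neg_distrib]
    refine Finset.sum_le_sum fun b _ => ?_
    have := (abs_le.1 (abs_kernel_le (lineAngle_mem (α - φ b)) (lineAngle_mem (β - φ b)))).1
    nlinarith [hμ b]
  unfold choice
  linarith

theorem choice_le (hμ : ∀ b, 0 ≤ μ b) (α β : ℝ) : choice μ φ α β ≤ ∑ b, μ b := by
  linarith [choice_add_choice μ φ α β, choice_nonneg (φ := φ) hμ β α]

theorem share_nonneg (hμ : ∀ b, 0 ≤ μ b) (b : B) (σ α : ℝ) : 0 ≤ share μ φ b σ α := by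
  unfold share
  split_ifs
  · exact div_nonneg (hμ b) (Finset.sum_nonneg fun b _ => hμ b)
  · exact div_nonneg (le_max_right _ _) (load_nonneg α)

theorem sum_max_mul_overlap (hφ : ∀ α, ∑ b, overlap μ φ b α = 0) {σ : ℝ} (hσ : σ = 1 ∨ σ = -1)
    (α : ℝ) : ∑ b, max (σ * overlap μ φ b α) 0 = load μ φ α := by
  rcases hσ with rfl | rfl
  · simp [load]
  · have : ∀ b, max (-1 * overlap μ φ b α) 0 = max (overlap μ φ b α) 0 - overlap μ φ b α :=
      fun b => by
        rcases le_total (overlap μ φ b α) 0 with h | h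
        · rw [max_eq_left (by linarith), max_eq_right h]
          ring
        · rw [max_eq_right (by linarith), max_eq_left h]
          ring
    rw [Finset.sum_congr rfl fun b _ => this b, Finset.sum_sub_distrib, hφ, sub_zero, load]

theorem sum_share (hφ : ∀ α, ∑ b, overlap μ φ b α = 0) {σ : ℝ} (hσ : σ = 1 ∨ σ = -1) (α : ℝ)
    (h : ∑ b, μ b ≠ 0) : ∑ b, share μ φ b σ α = 1 := by
  unfold share
  split_ifs with hl
  -- Where the load vanishes, the default value proportional to `μ` keeps the shares normalized.
  · rw [← Finset.sum_div, div_self h]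
  · rw [← Finset.sum_div, sum_max_mul_overlap hφ hσ, div_self hl]

theorem sum_share_mul (hμ : ∀ b, 0 ≤ μ b) (hφ : ∀ α, ∑ b, overlap μ φ b α = 0) {σ τ : ℝ}
    (hσ : σ = 1 ∨ σ = -1) (hτ : τ = 1 ∨ τ = -1) (α β : ℝ) :
    ∑ b, (choice μ φ α β * share μ φ b σ α + choice μ φ β α * share μ φ b τ β) = ∑ b, μ b := by
  rw [Finset.sum_add_distrib, ← Finset.mul_sum, ← Finset.mul_sum]
  by_cases h : ∑ b, μ b = 0
  -- If all `μ b` vanish, the shares need not sum to one, but both weights are zero.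
  · rw [le_antisymm (h ▸ choice_le hμ α β) (choice_nonneg hμ α β),
      le_antisymm (h ▸ choice_le hμ β α) (choice_nonneg hμ β α), h]
    ring
  · rw [sum_share hφ hσ α h, sum_share hφ hτ β h, mul_one, mul_one, choice_add_choice]

theorem share_le_one (hμ : ∀ b, 0 ≤ μ b) (hφ : ∀ α, ∑ b, overlap μ φ b α = 0) {σ : ℝ}
    (hσ : σ = 1 ∨ σ = -1) (b : B) (α : ℝ) : share μ φ b σ α ≤ 1 := by
  unfold share
  split_ifs
  · exact div_le_one_of_le₀ (Finset.single_le_sum (fun b _ => hμ b) (Finset.mem_univ b))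
      (Finset.sum_nonneg fun b _ => hμ b)
  · refine div_le_one_of_le₀ ?_ (load_nonneg α)
    rw [← sum_max_mul_overlap hφ hσ]
    exact Finset.single_le_sum (f := fun b => max (σ * overlap μ φ b α) 0)
      (fun b _ => le_max_right _ _) (Finset.mem_univ b)

theorem load_eq (hμ : ∀ b, 0 ≤ μ b) (hφ : ∀ α, ∑ b, overlap μ φ b α = 0) (α : ℝ) :
    load μ φ α = (∑ b, μ b * |Real.cos (α - φ b)|) / 2 := by
  have : ∀ b, max (overlap μ φ b α) 0 =
      (overlap μ φ b α + μ b * |Real.cos (α - φ b)|) / 2 := fun b => by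
    have h' : μ b * |Real.cos (α - φ b)| = |overlap μ φ b α| := by
      rw [overlap, abs_mul, abs_of_nonneg (hμ b)]
    rw [max_def', h']
    split_ifs with h
    · rw [abs_of_nonneg h]
      ring
    · rw [abs_of_neg (not_le.1 h)]
      ring
  rw [load, Finset.sum_congr rfl fun b _ => this b, ← Finset.sum_div, Finset.sum_add_distrib, hφ,
    zero_add]

/-- Averaging the kernel over β turns the constant half of `choice` into (π/4) ∑ μ b |cos(α - φ b)|:
the direction that Bob uses has density proportional to `load`. -/
theorem integral_choice (hμ : ∀ b, 0 ≤ μ b) (hφ : ∀ α, ∑ b, overlap μ φ b α = 0) (α : ℝ) :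
    ∫ β, choice μ φ α β ∂angle = Real.pi / 2 * load μ φ α := by
  have hint : ∀ b, Integrable (fun β => μ b * kernel (lineAngle (α - φ b)) (lineAngle (β - φ b)))
      angle := fun b => by
    refine (integrable_angle (C := 1) ?_ fun x => ?_).const_mul _
    · exact measurable_kernel.comp (measurable_const.prodMk
        (measurable_lineAngle.comp (measurable_id.sub_const _)))
    · exact abs_kernel_le (lineAngle_mem _) (lineAngle_mem _)
  unfold choice
  rw [integral_add (integrable_const _) ((integrable_finsetSum _ fun b _ => hint b).div_const 2),
    integral_const, probReal_univ, one_smul, integral_div, integral_finsetSum _ fun b _ => hint b]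
  simp only [integral_const_mul, integral_kernel_lineAngle]
  rw [load_eq hμ hφ, Finset.sum_congr rfl fun b _ => show μ b *
    (Real.pi / 2 * |Real.cos (α - φ b)| - 1) =
      Real.pi / 2 * (μ b * |Real.cos (α - φ b)|) - μ b by ring,
    Finset.sum_sub_distrib, ← Finset.mul_sum]
  ring

theorem load_mul_share (hφ : ∀ α, ∑ b, overlap μ φ b α = 0) {σ : ℝ} (hσ : σ = 1 ∨ σ = -1) (b : B)
    (α : ℝ) : load μ φ α * share μ φ b σ α = max (σ * overlap μ φ b α) 0 := by
  unfold share
  split_ifs with h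
  · rw [h, zero_mul]
    -- A vanishing load makes every positive part vanish, so the default value of `share` has no
    -- effect.
    rw [← sum_max_mul_overlap hφ hσ] at h
    exact ((Finset.sum_eq_zero_iff_of_nonneg fun b _ => le_max_right _ _).1 h b
      (Finset.mem_univ b)).symm
  · rw [mul_div_cancel₀ _ h]

theorem integrable_choice_mul_share (hμ : ∀ b, 0 ≤ μ b) (hφ : ∀ α, ∑ b, overlap μ φ b α = 0)
    (θ : ℝ) (b : B) : Integrable (fun z : ℝ × ℝ =>
      choice μ φ z.1 z.2 * share μ φ b (side θ z.1) z.1) (angle.prod angle) := by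
  refine Integrable.of_bound (C := ∑ b, μ b) (Measurable.aestronglyMeasurable
    ((measurable_choice μ φ).mul ((measurable_share μ φ b (measurable_side θ)).comp
      measurable_fst))) (Eventually.of_forall fun z => ?_)
  rw [Real.norm_of_nonneg (mul_nonneg (choice_nonneg hμ _ _) (share_nonneg hμ _ _ _))]
  exact (mul_le_of_le_one_right (choice_nonneg hμ _ _)
    (share_le_one hμ hφ (side_eq θ z.1) b z.1)).trans (choice_le hμ _ _)

theorem integral_choice_mul_share (hμ : ∀ b, 0 ≤ μ b) (hφ : ∀ α, ∑ b, overlap μ φ b α = 0)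
    (θ : ℝ) (b : B) : ∫ z : ℝ × ℝ, choice μ φ z.1 z.2 * share μ φ b (side θ z.1) z.1
      ∂(angle.prod angle) = μ b * (1 + Real.cos (θ - φ b)) / 2 := by
  rw [integral_prod _ (integrable_choice_mul_share hμ hφ θ b)]
  have : ∀ α, ∫ β, choice μ φ α β * share μ φ b (side θ α) α ∂angle =
      Real.pi / 2 * max (side θ α * overlap μ φ b α) 0 := fun α => by
    rw [integral_mul_const, integral_choice hμ hφ, mul_assoc, load_mul_share hφ (side_eq θ α)]
  simp only [this]
  rw [integral_const_mul, integral_max_side_mul_overlap hμ]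
  have := Real.pi_pos
  field_simp

end Decoding

/-! ### Encoding -/

/-- The two signs described by a message. -/
def signs : Fin 4 → ℝ × ℝ := ![(1, 1), (1, -1), (-1, 1), (-1, -1)]

noncomputable def message (θ : ℝ) (z : ℝ × ℝ) : Fin 4 :=
  if 0 ≤ Real.cos (z.1 - θ) then (if 0 ≤ Real.cos (z.2 - θ) then 0 else 1)
  else (if 0 ≤ Real.cos (z.2 - θ) then 2 else 3)

theorem signs_message (θ : ℝ) (z : ℝ × ℝ) :
    signs (message θ z) = (side θ z.1, side θ z.2) := by
  unfold message side
  split_ifs <;> rfl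

theorem signs_eq (c : Fin 4) :
    ((signs c).1 = 1 ∨ (signs c).1 = -1) ∧ ((signs c).2 = 1 ∨ (signs c).2 = -1) := by
  fin_cases c <;> simp [signs]

theorem measurable_message (θ : ℝ) : Measurable (message θ) := by
  have h1 : MeasurableSet {z : ℝ × ℝ | 0 ≤ Real.cos (z.1 - θ)} :=
    measurableSet_le measurable_const (by fun_prop)
  have h2 : MeasurableSet {z : ℝ × ℝ | 0 ≤ Real.cos (z.2 - θ)} :=
    measurableSet_le measurable_const (by fun_prop)
  exact Measurable.ite h1 (Measurable.ite h2 measurable_const measurable_const)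
    (Measurable.ite h2 measurable_const measurable_const)

section Decoding

variable {B : Type} [Fintype B] (p μ φ : B → ℝ)

/-- The probability of the outcome `b` with total weight `p b`, given the message `c`. -/
noncomputable def decode (c : Fin 4) (b : B) (z : ℝ × ℝ) : ℝ :=
  (p b - μ b) + (choice μ φ z.1 z.2 * share μ φ b (signs c).1 z.1 +
    choice μ φ z.2 z.1 * share μ φ b (signs c).2 z.2)

variable {p μ φ}

theorem measurable_decode (c : Fin 4) (b : B) : Measurable (decode p μ φ c b) := by
  refine measurable_const.add (Measurable.add ?_ ?_)
  · exact (measurable_choice μ φ).mul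
      ((measurable_share μ φ b measurable_const).comp measurable_fst)
  · exact ((measurable_choice μ φ).comp measurable_swap).mul
      ((measurable_share μ φ b measurable_const).comp measurable_snd)

theorem decode_nonneg (hμ : ∀ b, 0 ≤ μ b) (hp : ∀ b, μ b ≤ p b) (c : Fin 4) (b : B)
    (z : ℝ × ℝ) : 0 ≤ decode p μ φ c b z :=
  add_nonneg (sub_nonneg.2 (hp b)) (add_nonneg
    (mul_nonneg (choice_nonneg hμ _ _) (share_nonneg hμ _ _ _))
    (mul_nonneg (choice_nonneg hμ _ _) (share_nonneg hμ _ _ _)))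

theorem sum_decode (hμ : ∀ b, 0 ≤ μ b) (hφ : ∀ α, ∑ b, overlap μ φ b α = 0)
    (hp : ∑ b, p b = 1) (c : Fin 4) (z : ℝ × ℝ) : ∑ b, decode p μ φ c b z = 1 := by
  unfold decode
  rw [Finset.sum_add_distrib, sum_share_mul hμ hφ (signs_eq c).1 (signs_eq c).2,
    Finset.sum_sub_distrib, hp, sub_add_cancel]

theorem decode_message (θ : ℝ) (b : B) (z : ℝ × ℝ) :
    decode p μ φ (message θ z) b z =
      (p b - μ b) + (choice μ φ z.1 z.2 * share μ φ b (side θ z.1) z.1 +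
        choice μ φ z.swap.1 z.swap.2 * share μ φ b (side θ z.swap.1) z.swap.1) := by
  rw [decode, signs_message]
  rfl

theorem integrable_decode_message (hμ : ∀ b, 0 ≤ μ b) (hφ : ∀ α, ∑ b, overlap μ φ b α = 0)
    (θ : ℝ) (b : B) :
    Integrable (fun z => decode p μ φ (message θ z) b z) (angle.prod angle) := by
  simp only [decode_message]
  exact (integrable_const _).add ((integrable_choice_mul_share hμ hφ θ b).add
    (integrable_choice_mul_share hμ hφ θ b).swap)

/-- By symmetry each of the two directions contributes μ b (1 + cos(θ - φ b))/2; the excess `p b - μ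
b` of the effect's weight over its vector is output as noise independent of the message. -/
theorem integral_decode_message (hμ : ∀ b, 0 ≤ μ b) (hφ : ∀ α, ∑ b, overlap μ φ b α = 0)
    (θ : ℝ) (b : B) : ∫ z, decode p μ φ (message θ z) b z ∂(angle.prod angle) =
      p b + μ b * Real.cos (θ - φ b) := by
  have h := integrable_choice_mul_share hμ hφ θ b
  have h' : Integrable (fun z : ℝ × ℝ => choice μ φ z.swap.1 z.swap.2 *
    share μ φ b (side θ z.swap.1) z.swap.1) (angle.prod angle) := h.swap
  simp only [decode_message]
  rw [integral_add, integral_add h h',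
    integral_prod_swap fun z : ℝ × ℝ => choice μ φ z.1 z.2 * share μ φ b (side θ z.1) z.1,
    integral_choice_mul_share hμ hφ, integral_const, probReal_univ, one_smul]
  · ring
  · exact integrable_const _
  · exact h.add h'

end Decoding

end FourMessages

namespace FourMessages

/-! ### Bloch vectors -/

theorem posSemidef_two {A : Matrix (Fin 2) (Fin 2) ℝ} (h : A.PosSemidef) :
    A 1 0 = A 0 1 ∧ 0 ≤ A 0 0 ∧ 0 ≤ A 1 1 ∧ A 0 1 ^ 2 ≤ A 0 0 * A 1 1 := by
  have h1 : A 1 0 = A 0 1 := by simpa using h.isHermitian.apply 0 1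
  have h2 := h.det_nonneg
  rw [Matrix.det_fin_two, h1] at h2
  exact ⟨h1, h.diag_nonneg, h.diag_nonneg, by linarith⟩

/-- Half of the trace. -/
noncomputable def weight (A : Matrix (Fin 2) (Fin 2) ℝ) : ℝ := (A 0 0 + A 1 1) / 2

/-- The Bloch vector, normalized in such a way that it has at most the length `weight A`. -/
noncomputable def vector (A : Matrix (Fin 2) (Fin 2) ℝ) : ℂ := ⟨A 0 1, (A 0 0 - A 1 1) / 2⟩

theorem norm_vector_le {A : Matrix (Fin 2) (Fin 2) ℝ} (h : A.PosSemidef) :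
    ‖vector A‖ ≤ weight A := by
  obtain ⟨-, h0, h1, h2⟩ := posSemidef_two h
  have hw : 0 ≤ weight A := div_nonneg (add_nonneg h0 h1) zero_le_two
  rw [← pow_le_pow_iff_left₀ (norm_nonneg _) hw two_ne_zero, Complex.sq_norm,
    Complex.normSq_apply]
  change A 0 1 * A 0 1 + (A 0 0 - A 1 1) / 2 * ((A 0 0 - A 1 1) / 2) ≤
    ((A 0 0 + A 1 1) / 2) ^ 2
  linarith

theorem trace_mul_eq {A A' : Matrix (Fin 2) (Fin 2) ℝ} (h : A.PosSemidef) (h' : A'.PosSemidef) :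
    (A * A').trace = 2 * (weight A * weight A' +
      ‖vector A‖ * ‖vector A'‖ * Real.cos ((vector A).arg - (vector A').arg)) := by
  have e : ‖vector A‖ * ‖vector A'‖ * Real.cos ((vector A).arg - (vector A').arg) =
      A 0 1 * A' 0 1 + (A 0 0 - A 1 1) / 2 * ((A' 0 0 - A' 1 1) / 2) := by
    have h1 := Complex.norm_mul_cos_arg (vector A)
    have h2 := Complex.norm_mul_sin_arg (vector A)
    have h3 := Complex.norm_mul_cos_arg (vector A')
    have h4 := Complex.norm_mul_sin_arg (vector A')
    have e1 : (vector A).re * (vector A').re + (vector A).im * (vector A').im =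
        A 0 1 * A' 0 1 + (A 0 0 - A 1 1) / 2 * ((A' 0 0 - A' 1 1) / 2) := rfl
    rw [← e1, ← h1, ← h2, ← h3, ← h4, Real.cos_sub]
    ring
  rw [e, weight, weight, Matrix.trace_fin_two, Matrix.mul_apply, Matrix.mul_apply,
    Fin.sum_univ_two, Fin.sum_univ_two, (posSemidef_two h).1, (posSemidef_two h').1]
  ring

section

variable {B : Type} [Fintype B] (M : RebitPOVM B)

theorem sum_weight : ∑ b, weight (M.effect b) = 1 := by
  have h0 : ∑ b, M.effect b 0 0 = 1 := by
    rw [← Matrix.sum_apply, M.sum_eq_one, Matrix.one_apply_eq]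
  have h1 : ∑ b, M.effect b 1 1 = 1 := by
    rw [← Matrix.sum_apply, M.sum_eq_one, Matrix.one_apply_eq]
  simp only [weight, ← Finset.sum_div, Finset.sum_add_distrib, h0, h1]
  norm_num

theorem sum_vector : ∑ b, vector (M.effect b) = 0 := by
  have h0 : ∑ b, M.effect b 0 0 = 1 := by
    rw [← Matrix.sum_apply, M.sum_eq_one, Matrix.one_apply_eq]
  have h1 : ∑ b, M.effect b 1 1 = 1 := by
    rw [← Matrix.sum_apply, M.sum_eq_one, Matrix.one_apply_eq]
  have h2 : ∑ b, M.effect b 0 1 = 0 := by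
    rw [← Matrix.sum_apply, M.sum_eq_one, Matrix.one_apply_ne (by decide)]
  refine Complex.ext ?_ ?_
  · rw [Complex.re_sum]
    exact h2
  · rw [Complex.im_sum]
    change ∑ b, (M.effect b 0 0 - M.effect b 1 1) / 2 = 0
    rw [← Finset.sum_div, Finset.sum_sub_distrib, h0, h1, sub_self, zero_div]

theorem sum_overlap_vector (α : ℝ) :
    ∑ b, overlap (fun b => ‖vector (M.effect b)‖) (fun b => (vector (M.effect b)).arg) b α = 0 := by
  have h : ∀ b, overlap (fun b => ‖vector (M.effect b)‖) (fun b => (vector (M.effect b)).arg) b α =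
      Real.cos α * (vector (M.effect b)).re + Real.sin α * (vector (M.effect b)).im := fun b => by
    rw [overlap, Real.cos_sub, ← Complex.norm_mul_cos_arg, ← Complex.norm_mul_sin_arg]
    ring
  rw [Finset.sum_congr rfl fun b _ => h b, Finset.sum_add_distrib, ← Finset.mul_sum,
    ← Finset.mul_sum, ← Complex.re_sum, ← Complex.im_sum, sum_vector]
  simp

end

/-! ### The classical model -/

/-- Twice the length of `vector ρ.mat` is the length of the usual Bloch vector. -/
noncomputable def encode (ρ : RebitState) (z : ℝ × ℝ) (c : Fin 4) : ℝ :=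
  (1 + 2 * ‖vector ρ.mat‖) / 2 * (if message (vector ρ.mat).arg z = c then 1 else 0) +
    (1 - 2 * ‖vector ρ.mat‖) / 2 * (if message ((vector ρ.mat).arg + Real.pi) z = c then 1 else 0)

theorem weight_state (ρ : RebitState) : weight ρ.mat = 1 / 2 := by
  have := ρ.trace_eq_one
  rw [Matrix.trace_fin_two] at this
  rw [weight, this]

theorem measurable_indicator_message (θ : ℝ) (c : Fin 4) :
    Measurable fun z => if message θ z = c then (1 : ℝ) else 0 :=
  (measurable_of_finite fun k : Fin 4 => if k = c then (1 : ℝ) else 0).comp (measurable_message θ)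

theorem encode_nonneg (ρ : RebitState) (z : ℝ × ℝ) (c : Fin 4) : 0 ≤ encode ρ z c := by
  have h := norm_vector_le ρ.posSemidef
  rw [weight_state] at h
  have h0 := norm_nonneg (vector ρ.mat)
  unfold encode
  refine add_nonneg (mul_nonneg (by linarith) ?_) (mul_nonneg (by linarith) ?_) <;>
    split_ifs <;> norm_num

theorem sum_encode_mul (ρ : RebitState) (z : ℝ × ℝ) (f : Fin 4 → ℝ) :
    ∑ c, encode ρ z c * f c =
      (1 + 2 * ‖vector ρ.mat‖) / 2 * f (message (vector ρ.mat).arg z) +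
        (1 - 2 * ‖vector ρ.mat‖) / 2 * f (message ((vector ρ.mat).arg + Real.pi) z) := by
  simp only [encode, add_mul, Finset.sum_add_distrib, mul_assoc, ← Finset.mul_sum, ite_mul,
    one_mul, zero_mul, Finset.sum_ite_eq, Finset.mem_univ, if_true]

/-- With r = 2 ‖vector ρ‖, the state is the mixture of two antipodal pure states with weights (1 ±
r)/2; their cosines are opposite, which leaves the factor r. -/
theorem integral_encode_mul_decode {B : Type} [Fintype B] (ρ : RebitState) (M : RebitPOVM B)
    (b : B) : ∫ z, ∑ c, encode ρ z c * decode (fun b => weight (M.effect b))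
      (fun b => ‖vector (M.effect b)‖) (fun b => (vector (M.effect b)).arg) c b z
        ∂(angle.prod angle) = bornProb ρ M b := by
  have hi := fun θ => integrable_decode_message (p := fun b => weight (M.effect b))
    (fun _ => norm_nonneg _) (sum_overlap_vector M) θ b
  have he := fun θ => integral_decode_message (p := fun b => weight (M.effect b))
    (fun _ => norm_nonneg _) (sum_overlap_vector M) θ b
  simp only [sum_encode_mul ρ _ fun c => decode _ _ _ c b _]
  rw [integral_add ((hi _).const_mul _) ((hi _).const_mul _), integral_const_mul,
    integral_const_mul, he, he, bornProb, trace_mul_eq ρ.posSemidef (M.posSemidef b),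
    weight_state, add_sub_right_comm, Real.cos_add_pi]
  ring

/-- Optimality compares models whose randomness lives in one universe, hence the lift of ℝ × ℝ. -/
noncomputable def model : ClassicalModel rebitBehavior 4 (ULift.{u} (ℝ × ℝ)) where
  prob := (angle.prod angle).map ULift.up
  isProbabilityMeasure := Measure.isProbabilityMeasure_map measurable_up.aemeasurable
  enc ρ l c := encode ρ l.down c
  enc_measurable ρ c := by
    refine Measurable.comp (g := fun z => encode ρ z c) ?_ measurable_down
    exact ((measurable_indicator_message _ c).const_mul _).add
      ((measurable_indicator_message _ c).const_mul _)
  enc_nonneg ρ l c := encode_nonneg ρ l.down c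
  enc_sum ρ l := by
    have := sum_encode_mul ρ l.down fun _ => 1
    simp only [mul_one] at this
    rw [this]
    ring
  dec c M l b := decode (fun b => weight (M.2.effect b)) (fun b => ‖vector (M.2.effect b)‖)
    (fun b => (vector (M.2.effect b)).arg) c b l.down
  dec_measurable c M b := (measurable_decode c b).comp measurable_down
  dec_nonneg c M l b := decode_nonneg (fun _ => norm_nonneg _)
    (fun b => norm_vector_le (M.2.posSemidef b)) c b l.down
  dec_sum c M l := sum_decode (fun _ => norm_nonneg _) (sum_overlap_vector M.2) (sum_weight M.2) c
    l.down
  simulates ρ M b := by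
    refine ((MeasurableEquiv.ulift.symm.measurableEmbedding).integral_map _).trans ?_
    exact integral_encode_mul_decode ρ M.2 b

end FourMessages

/-! ### The main theorem -/

theorem mainTheorem5 :
    (∀ (d : ℕ) (Λ : Type u) [MeasurableSpace Λ] (P : ClassicalModel rebitBehavior d Λ),
      P.IsOptimal →
        (d = 3 ∧ ∀ D : RebitState → Λ → Fin d, P.IsDeterministicEncoding D →
          ∃ᶠ l in ae P.prob, 7 ≤ sectionNumber fun ρ => D ρ l) ∨
        d = 4) ∧
    (∀ (Λ : Type u) [MeasurableSpace Λ] (P : ClassicalModel gridBehavior 3 Λ)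
      (D : Fin 32 → Λ → Fin 3), P.IsDeterministicEncoding D →
        ∃ᶠ l in ae P.prob, 7 ≤ gridSectionNumber fun x => D x l) := by
  refine ⟨fun d Λ _ P hP => ?_, fun Λ _ P D hD => frequently_seven_le_gridSectionNumber P D hD⟩
  have h3 := three_le_of_classicalModel P
  have h4 : d ≤ 4 := hP 4 _ ⟨FourMessages.model⟩
  interval_cases d
  · exact Or.inl ⟨rfl, fun D hD => frequently_seven_le_sectionNumber P D hD⟩
  · exact Or.inr rfl
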